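/- **Setting.** Let $d\ge 1$. A dataset $D=(D_1,\dots,D_n)$ consists of $n$ records in $[0,1]^d$. A query $q=(c_1,\dots,c_d,r_1,\dots,r_d)\in Q=[0,1]^{2d}$ matches a record $p$ if $c_j\le p_j\le c_j+r_j$ for all $j$; $c_D(q)$ is the number of records of $D$ that match $q$. For probability distributions $\chi=(\chi_1,\dots,\chi_n)$ on $[0,1]^d$ write $D\sim\chi$ if the $D_i$ are independent with $D_i\sim\chi_i$, and put $c_\chi(q)=\mathbb E_{D\sim\chi}[c_D(q)]$. For a single distribution $\mu$ put $c_\mu(q)=\mathbb P_{p\sim\mu}[p\text{ matches }q]$. **Computation.** Programs run on a real RAM (arrays of reals with indices computed at run time; arithmetic, floor, comparison and array access cost one operation each). A learning algorithm consists of a training program, which maps $D$ to a finite table of natural numbers, and an inference program, which computes a function $\hat f=\hat f_D$ on $Q$ from the table. The space of the model $\hat f$ is the length of the inference program (with each real constant counted as one unit) plus the number of bits of the table. **Learnability.** Given $\kappa_1,\kappa_2>0$ and parameters $T_n,S_n,B_n$, an algorithm learns $\chi=(\chi_1,\dots,\chi_n)$ if (i) for all $\epsilon\ge\sqrt n$,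 $$\mathbb P_{D\sim\chi}\Big[\sup_{q\in Q}|c_\chi(q)-\hat f(q)|\ge\epsilon\Big]\le\kappa_1e^{-\kappa_2(\epsilon/\sqrt n-1)^2};$$ (ii) for every dataset of size $n$, each evaluation of $\hat f$ on $Q$ takes at most $T_n$ operations and the space of $\hat f$ is at most $S_n$; (iii) training on any dataset of size $n$ takes at most $nB_n$ operations. A class $\mathfrak X$ of distributions is *distribution learnable for cardinality estimation* with parameters $T_n,S_n,B_n$ if for all $n\ge1$ and all $\chi=(\chi_1,\dots,\chi_n)$ with $\chi_i\in\mathfrak X$ there is an algorithm that learns $\chi$; it is *uniformly* so if a single algorithm works for all such $n$ and $\chi$. **Lemma.** There is a universal constant $C$ such that for every $d\ge1$ there are positive constants $\kappa_1,\kappa_2,C'$, depending only on $d$, for which the following hold. 1. Let $\mathfrak X_\rho$ be the set of distributions $\mu$ on $[0,1]^d$ for which $c_\mu$ is differentiable on $\{(c,r): c_j\ge0,\ r_j\ge0,\ c_j+r_j\le1 \text{ for all } j\}$ (relative to this set) with gradient of Euclidean norm at most $\rho$. For every $\rho$ with $\mathfrak X_\rho\neq\emptyset$, $\mathfrak X_\rho$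 is uniformly distribution learnable for cardinality estimation (with constants $\kappa_1,\kappa_2$) with parameters satisfying $T_n\le C'$ for all $n$, and, for all $n\ge2$, $$S_n\le C\sqrt{2d}\,(\rho\sqrt n)^{2d}\log n,\qquad B_n\le C\sqrt{2d}\,(\rho\sqrt n)^{2d}\log n .$$ 2. Let $\mathfrak X_c$ be a finite set of $c$ distributions on $[0,1]^d$ such that for each $\mu\in\mathfrak X_c$ some fixed model (program and table) computes $c_\mu$ exactly on $Q$ in a bounded number of operations. Then $\mathfrak X_c$ is distribution learnable for cardinality estimation (with constants $\kappa_1,\kappa_2$) with $T_n=O(1)$, $S_n=O(1)$ and $nB_n=O(1)$, where the implied constants depend only on $\mathfrak X_c$ (and not on $n$ or $\chi$). -/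

import Mathlib

open MeasureTheory

/-! ### Datasets, queries and cardinality functions -/

/-- A `d`-dimensional data record; the data domain is `[0,1]^d`. -/
abbrev DataPoint (d : ℕ) : Type := Fin d → unitInterval

/-- A dataset of `n` records. -/
abbrev Dataset (d n : ℕ) : Type := Fin n → DataPoint d

/-- A range query `q = (c₁, …, c_d, r₁, …, r_d)`: `q (Sum.inl i)` is `cᵢ`, `q (Sum.inr i)` is `rᵢ`.
The space of queries carries the Euclidean norm. -/
abbrev RangeQuery (d : ℕ) : Type := EuclideanSpace ℝ (Fin d ⊕ Fin d)

/-- The queries that may be asked: all `cᵢ` and `rᵢ` lie in `[0,1]`. -/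
def queryDomain (d : ℕ) : Set (RangeQuery d) := {q | ∀ k, q k ∈ Set.Icc (0 : ℝ) 1}

/-- The queries whose box `∏ [cᵢ, cᵢ + rᵢ]` lies inside the data domain `[0,1]^d`. -/
def innerQueryDomain (d : ℕ) : Set (RangeQuery d) :=
  {q | ∀ i : Fin d, 0 ≤ q (Sum.inl i) ∧ 0 ≤ q (Sum.inr i) ∧ q (Sum.inl i) + q (Sum.inr i) ≤ 1}

/-- The records that match the query `q`. -/
def queryBox {d : ℕ} (q : RangeQuery d) : Set (DataPoint d) :=
  {p | ∀ i, q (Sum.inl i) ≤ (p i : ℝ) ∧ (p i : ℝ) ≤ q (Sum.inl i) + q (Sum.inr i)}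

/-- The cardinality function `c_D(q)`: the number of records of `D` that match `q`. -/
noncomputable def cardinalityFn {d n : ℕ} (D : Dataset d n) (q : RangeQuery d) : ℝ :=
  (Nat.card {i : Fin n // D i ∈ queryBox q} : ℝ)

/-- The law of `D ∼ χ`: the records are independent and the `i`-th one has distribution `χ i`. -/
noncomputable def samplingLaw {d n : ℕ} (χ : Fin n → ProbabilityMeasure (DataPoint d)) :
    Measure (Dataset d n) :=
  Measure.pi fun i => (χ i : Measure (DataPoint d))

/-- The distribution cardinality function `c_χ(q) = 𝔼_{D ∼ χ}[c_D(q)]`. -/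
noncomputable def distCardinalityFn {d n : ℕ} (χ : Fin n → ProbabilityMeasure (DataPoint d))
    (q : RangeQuery d) : ℝ :=
  ∫ D, cardinalityFn D q ∂(samplingLaw χ)

/-- The distribution cardinality function of one distribution, per sampled record: the probability
that a record sampled from `μ` matches `q`. -/
noncomputable def matchProb {d : ℕ} (μ : ProbabilityMeasure (DataPoint d)) (q : RangeQuery d) : ℝ :=
  (μ : Measure (DataPoint d)).real (queryBox q)

/-! ### A real RAM with a step count

Programs work on named arrays of real numbers; array names are fixed in the program text, while
indices are computed at run time.  Arithmetic, rounding, comparison and array access each cost one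
operation. -/

/-- Expressions. `read a e` is the entry of the array `a` at the index given by `e`. -/
inductive RamExpr : Type
  | const (x : ℝ)
  | read (a : ℕ) (e : RamExpr)
  | add (e₁ e₂ : RamExpr)
  | sub (e₁ e₂ : RamExpr)
  | mul (e₁ e₂ : RamExpr)
  | div (e₁ e₂ : RamExpr)
  | floor (e : RamExpr)

/-- Programs. `write a i e` stores the value of `e` in the array `a` at index `i`; `emit e` appends
the natural number given by `e` to the output; `branch e₁ e₂ c₁ c₂` is "if `e₁ ≤ e₂` then `c₁` else
`c₂`" and `loop e₁ e₂ c` is "while `e₁ ≤ e₂` do `c`". -/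
inductive RamProg : Type
  | skip
  | write (a : ℕ) (i e : RamExpr)
  | emit (e : RamExpr)
  | seq (c₁ c₂ : RamProg)
  | branch (e₁ e₂ : RamExpr) (c₁ c₂ : RamProg)
  | loop (e₁ e₂ : RamExpr) (c : RamProg)

/-- A state of the machine: the contents of the arrays and the output emitted so far. -/
structure RamState : Type where
  arr : ℕ → ℕ → ℝ
  out : List ℕ

/-- The value of an expression. A real number used as an index is rounded down. -/
noncomputable def RamExpr.eval (s : RamState) : RamExpr → ℝ
  | .const x => x
  | .read a e => s.arr a ⌊e.eval s⌋₊
  | .add e₁ e₂ => e₁.eval s + e₂.eval s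
  | .sub e₁ e₂ => e₁.eval s - e₂.eval s
  | .mul e₁ e₂ => e₁.eval s * e₂.eval s
  | .div e₁ e₂ => e₁.eval s / e₂.eval s
  | .floor e => (⌊e.eval s⌋ : ℝ)

/-- The number of nodes of an expression; this is both its length and the number of operations
needed to evaluate it. -/
def RamExpr.size : RamExpr → ℕ
  | .const _ => 1
  | .read _ e => e.size + 1
  | .add e₁ e₂ => e₁.size + e₂.size + 1
  | .sub e₁ e₂ => e₁.size + e₂.size + 1
  | .mul e₁ e₂ => e₁.size + e₂.size + 1
  | .div e₁ e₂ => e₁.size + e₂.size + 1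
  | .floor e => e.size + 1

/-- The length of a program. -/
def RamProg.size : RamProg → ℕ
  | .skip => 1
  | .write _ i e => i.size + e.size + 1
  | .emit e => e.size + 1
  | .seq c₁ c₂ => c₁.size + c₂.size + 1
  | .branch e₁ e₂ c₁ c₂ => e₁.size + e₂.size + c₁.size + c₂.size + 1
  | .loop e₁ e₂ c => e₁.size + e₂.size + c.size + 1

/-- `RamExec c s t s'`: started in state `s`, the program `c` halts in state `s'` after exactly `t`
operations. -/
inductive RamExec : RamProg → RamState → ℕ → RamState → Prop
  | skip (s : RamState) : RamExec .skip s 1 s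
  | write (s : RamState) (a : ℕ) (i e : RamExpr) :
      RamExec (.write a i e) s (i.size + e.size + 1)
        ⟨Function.update s.arr a (Function.update (s.arr a) ⌊i.eval s⌋₊ (e.eval s)), s.out⟩
  | emit (s : RamState) (e : RamExpr) :
      RamExec (.emit e) s (e.size + 1) ⟨s.arr, s.out ++ [⌊e.eval s⌋₊]⟩
  | seq {s s₁ s₂ : RamState} {t₁ t₂ : ℕ} {c₁ c₂ : RamProg}
      (h₁ : RamExec c₁ s t₁ s₁) (h₂ : RamExec c₂ s₁ t₂ s₂) :
      RamExec (.seq c₁ c₂) s (t₁ + t₂) s₂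
  | branch_true {s s' : RamState} {t : ℕ} {e₁ e₂ : RamExpr} {c₁ c₂ : RamProg}
      (h : e₁.eval s ≤ e₂.eval s) (h₁ : RamExec c₁ s t s') :
      RamExec (.branch e₁ e₂ c₁ c₂) s (e₁.size + e₂.size + 1 + t) s'
  | branch_false {s s' : RamState} {t : ℕ} {e₁ e₂ : RamExpr} {c₁ c₂ : RamProg}
      (h : ¬ e₁.eval s ≤ e₂.eval s) (h₂ : RamExec c₂ s t s') :
      RamExec (.branch e₁ e₂ c₁ c₂) s (e₁.size + e₂.size + 1 + t) s'
  | loop_stop {s : RamState} {e₁ e₂ : RamExpr} {c : RamProg}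
      (h : ¬ e₁.eval s ≤ e₂.eval s) :
      RamExec (.loop e₁ e₂ c) s (e₁.size + e₂.size + 1) s
  | loop_step {s s₁ s₂ : RamState} {t₁ t₂ : ℕ} {e₁ e₂ : RamExpr} {c : RamProg}
      (h : e₁.eval s ≤ e₂.eval s) (h₁ : RamExec c s t₁ s₁)
      (h₂ : RamExec (.loop e₁ e₂ c) s₁ t₂ s₂) :
      RamExec (.loop e₁ e₂ c) s (e₁.size + e₂.size + 1 + t₁ + t₂) s₂

/-- The start of a training run: array `0` holds the number `n` of records (at index `0`), array `1`
holds the records, one after the other (coordinate `j` of record `i` at index `i * d + j`), and all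
other entries are `0`. -/
noncomputable def trainStart {d n : ℕ} (D : Dataset d n) : RamState where
  arr a k :=
    if a = 0 ∧ k = 0 then (n : ℝ)
    else if h : a = 1 ∧ k < n * d then
      (D (finProdFinEquiv.symm ⟨k, h.2⟩).1 (finProdFinEquiv.symm ⟨k, h.2⟩).2 : ℝ)
    else 0
  out := []

/-- The start of an evaluation run: array `0` holds the query `c₁, …, c_d, r₁, …, r_d`, array `1`
holds the stored table, and all other entries are `0`. -/
noncomputable def evalStart {d : ℕ} (table : List ℕ) (q : RangeQuery d) : RamState where
  arr a k :=
    if h : a = 0 ∧ k < d + d then q (finSumFinEquiv.symm ⟨k, h.2⟩)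
    else if a = 1 then ((table.getD k 0 : ℕ) : ℝ)
    else 0
  out := []

/-- A model of a function of queries: a program together with a table of natural numbers that the
program can read. -/
structure QueryModel : Type where
  code : RamProg
  table : List ℕ

/-- The space needed to store a model: the length of its program plus the number of bits of its
table (each entry is stored in binary, with one extra bit as a separator). -/
def QueryModel.space (m : QueryModel) : ℕ :=
  m.code.size + (m.table.map fun x => Nat.size x + 1).sum

/-- On the query `q` the model answers `v` using at most `T` operations. The answer is found at
index `0` of array `2`. -/
def QueryModel.Answers {d : ℕ} (m : QueryModel) (q : RangeQuery d) (v T : ℝ) : Prop :=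
  ∃ (t : ℕ) (s : RamState),
    RamExec m.code (evalStart m.table q) t s ∧ s.arr 2 0 = v ∧ (t : ℝ) ≤ T

/-! ### Distribution learnability for cardinality estimation -/

/-- A learning algorithm: `train` maps a dataset to a table, and the model it returns consists of
the program `infer` and that table. -/
structure CardinalityLearner : Type where
  train : RamProg
  infer : RamProg

/-- The supremum norm over the query domain, as an extended nonnegative real. -/
noncomputable def querySupNorm {d : ℕ} (g : RangeQuery d → ℝ) : ENNReal :=
  ⨆ q ∈ queryDomain d, ENNReal.ofReal |g q|

/-- The algorithm `L` models data sampled from `χ = (χ₁, …, χ_n)` with accuracy constants `κ₁`, `κ₂`,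
inference time `T`, space `S` and training cost `B` per record (so `n * B` in total). Here
`table D` is what training on `D` outputs and `fhat D` is the function that the returned model
computes. -/
def CardinalityLearner.Learns (L : CardinalityLearner) {d n : ℕ}
    (χ : Fin n → ProbabilityMeasure (DataPoint d)) (κ₁ κ₂ T S B : ℝ) : Prop :=
  ∃ (table : Dataset d n → List ℕ) (fhat : Dataset d n → RangeQuery d → ℝ),
    (∀ D, ∃ (t : ℕ) (s : RamState),
      RamExec L.train (trainStart D) t s ∧ s.out = table D ∧ (t : ℝ) ≤ n * B) ∧
    (∀ D, ∀ q ∈ queryDomain d, QueryModel.Answers ⟨L.infer, table D⟩ q (fhat D q) T) ∧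
    (∀ D, (QueryModel.space ⟨L.infer, table D⟩ : ℝ) ≤ S) ∧
    (∀ ε : ℝ, √(n : ℝ) ≤ ε →
      samplingLaw χ {D | ENNReal.ofReal ε ≤
          querySupNorm fun q => distCardinalityFn χ q - fhat D q} ≤
        ENNReal.ofReal (κ₁ * Real.exp (-κ₂ * (ε / √(n : ℝ) - 1) ^ 2)))

/-- The class `X` is distribution learnable for cardinality estimation with parameters `T`, `S`, `B`
(functions of the dataset size): for all `χ = (χ₁, …, χ_n)` in `X` there is a learning algorithm. -/
def DistributionLearnable {d : ℕ} (X : Set (ProbabilityMeasure (DataPoint d)))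
    (κ₁ κ₂ : ℝ) (T S B : ℕ → ℝ) : Prop :=
  ∀ n : ℕ, 0 < n → ∀ χ : Fin n → ProbabilityMeasure (DataPoint d), (∀ i, χ i ∈ X) →
    ∃ L : CardinalityLearner, L.Learns χ κ₁ κ₂ (T n) (S n) (B n)

/-- The stronger property that one and the same algorithm, which knows neither `χ` nor, in advance,
the dataset size, works for all `n` and all `χ = (χ₁, …, χ_n)` in `X`. -/
def UniformlyDistributionLearnable {d : ℕ} (X : Set (ProbabilityMeasure (DataPoint d)))
    (κ₁ κ₂ : ℝ) (T S B : ℕ → ℝ) : Prop :=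
  ∃ L : CardinalityLearner,
    ∀ n : ℕ, 0 < n → ∀ χ : Fin n → ProbabilityMeasure (DataPoint d), (∀ i, χ i ∈ X) →
      L.Learns χ κ₁ κ₂ (T n) (S n) (B n)

theorem UniformlyDistributionLearnable.distributionLearnable {d : ℕ}
    {X : Set (ProbabilityMeasure (DataPoint d))} {κ₁ κ₂ : ℝ} {T S B : ℕ → ℝ}
    (h : UniformlyDistributionLearnable X κ₁ κ₂ T S B) : DistributionLearnable X κ₁ κ₂ T S B := by
  obtain ⟨L, hL⟩ := h
  exact fun n hn χ hχ => ⟨L, hL n hn χ hχ⟩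

/-! ### The two distribution classes -/

/-- The distributions whose distribution cardinality function (per sampled record) is differentiable
on the queries inside the data domain, with gradient of Euclidean norm at most `ρ`. -/
def boundedGradientClass (d : ℕ) (ρ : ℝ) : Set (ProbabilityMeasure (DataPoint d)) :=
  {μ | ∀ q ∈ innerQueryDomain d, ∃ v : RangeQuery d,
    HasGradientWithinAt (matchProb μ) v (innerQueryDomain d) q ∧ ‖v‖ ≤ ρ}

/-- The distribution cardinality function of `μ` can be stored and evaluated in constant time: some
fixed model computes it, exactly, within a bounded number of operations. -/
def ConstantTimeCardinality {d : ℕ} (μ : ProbabilityMeasure (DataPoint d)) : Prop :=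
  ∃ (m : QueryModel) (T : ℝ), ∀ q ∈ queryDomain d, m.Answers q (matchProb μ q) T

/-! Part 1. Divide each axis of [0,1]^d into k cells and tabulate, for every pair of corner cells,
how many records lie between them. A query is rounded outwards to the grid and answered by one
look-up. In the 2d integer coordinates given by the cell indices of a record and their reflections,
a grid box is an orthant, so there are k^(2d) table entries, numbered by their digits in base k.

Bias: rounding only adds records from the cells that contain the faces of the box. The gradient
bound gives a slab of width w mass at most ρw (`measureReal_slab_le`), so the bias is at most
2dnρ/k, which is O(d√n) once k is of order ρ√n.

Fluctuation: the tail must be sub-Gaussian at scale √n with no factor growing with k or n, which a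
union bound over the k^(2d) boxes would not give. Symmetrization
(`measure_deviation_le_of_rademacher`) replaces centred counts by Rademacher sums. Lévy's
reflection, used once per orthant coordinate (`ncard_exists_orthant_le`), bounds the maximum over
all orthants at the cost of a factor 2^(2d), and Hoeffding's inequality finishes. Deviations ε up to
a fixed multiple of √n, where the bias matters, are absorbed into κ₁.

Cost: k is the largest integer with 2k² ≤ ρ²n (but at least 1), so for n ≥ 2 the table has at most
2^(-d)(ρ√n)^(2d) entries. The saved factor 2^d pays for program lengths quadratic in d; this keeps C
independent of d.

Part 2. The function c_χ is the combination of the finitely many c_μ weighted by their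
multiplicities in χ. The learner may depend on χ, so the weights enter the inference program as real
constants of unit size. There is no error, and nothing is trained. -/

/-! ### Maximal inequalities for Rademacher sums -/

section Rademacher

variable {ι : Type*} [Fintype ι]

/-- Lévy's inequality, by reflection: taking the maximum over all initial segments of the index set
(ordered by `h`) at most doubles the probability of a deviation. -/
theorem ncard_exists_threshold_le {𝒜 : Type*} (w : 𝒜 → ι → ℝ) (h : ι → ℕ) (x : ℝ) :
    {σ : ι → ℤˣ | ∃ (a : 𝒜) (b : ℕ),
        x ≤ |∑ i, if h i ≤ b then w a i * ((σ i : ℤ) : ℝ) else 0|}.ncard ≤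
      2 * {σ : ι → ℤˣ | ∃ a : 𝒜, x ≤ |∑ i, w a i * ((σ i : ℤ) : ℝ)|}.ncard := by
  classical
  set P : ℕ → (ι → ℤˣ) → Prop := fun b σ =>
    ∃ a, x ≤ |∑ i, if h i ≤ b then w a i * ((σ i : ℤ) : ℝ) else 0| with hP
  set G : Set (ι → ℤˣ) := {σ | ∃ a : 𝒜, x ≤ |∑ i, w a i * ((σ i : ℤ) : ℝ)|} with hG
  let flip : ℕ → (ι → ℤˣ) → (ι → ℤˣ) := fun b σ i => if h i ≤ b then σ i else -σ i
  have hflip : ∀ b σ, flip b (flip b σ) = σ := by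
    intro b σ
    funext i
    by_cases hi : h i ≤ b <;> simp [flip, hi]
  -- Reversing the signs beyond level b leaves the partial sums up to level b alone. Hence σ and its
  -- reflection have the same first crossing level, which makes φ an involution.
  have hPflip : ∀ b b' σ, b' ≤ b → (P b' (flip b σ) ↔ P b' σ) := by
    intro b b' σ hb
    have key : ∀ a, (∑ i, if h i ≤ b' then w a i * ((flip b σ i : ℤ) : ℝ) else 0) =
        ∑ i, if h i ≤ b' then w a i * ((σ i : ℤ) : ℝ) else 0 := by
      intro a
      refine Finset.sum_congr rfl fun i _ => ?_
      by_cases hi : h i ≤ b'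
      · simp [flip, hi, hi.trans hb]
      · simp [hi]
    simp only [hP, key]
  let φ : (ι → ℤˣ) → (ι → ℤˣ) := fun σ =>
    if hb : ∃ b, P b σ then flip (Nat.find hb) σ else σ
  have hφ : Function.Involutive φ := by
    intro σ
    by_cases hb : ∃ b, P b σ
    · have h1 : φ σ = flip (Nat.find hb) σ := by simp only [φ, dif_pos hb]
      have hb' : ∃ b, P b (flip (Nat.find hb) σ) :=
        ⟨Nat.find hb, (hPflip _ _ _ le_rfl).2 (Nat.find_spec hb)⟩
      have h2 : Nat.find hb' = Nat.find hb := by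
        rw [Nat.find_eq_iff]
        refine ⟨(hPflip _ _ _ le_rfl).2 (Nat.find_spec hb), fun n hn hPn => ?_⟩
        exact Nat.find_min hb hn ((hPflip _ _ _ hn.le).1 hPn)
      rw [h1]
      simp only [φ, dif_pos hb', h2, hflip]
    · simp only [φ, dif_neg hb]
  have hsub : {σ : ι → ℤˣ | ∃ (a : 𝒜) (b : ℕ),
      x ≤ |∑ i, if h i ≤ b then w a i * ((σ i : ℤ) : ℝ) else 0|} ⊆ G ∪ φ ⁻¹' G := by
    rintro σ ⟨a₀, b₀, hab⟩
    have hb : ∃ b, P b σ := ⟨b₀, a₀, hab⟩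
    obtain ⟨a, ha⟩ := Nat.find_spec hb
    have h1 : φ σ = flip (Nat.find hb) σ := by simp only [φ, dif_pos hb]
    -- The terms beyond the crossing level cancel, so one of the two full sums must reach x in
    -- absolute value.
    have hsum : (∑ i, w a i * ((σ i : ℤ) : ℝ)) + ∑ i, w a i * ((φ σ i : ℤ) : ℝ) =
        2 * ∑ i, if h i ≤ Nat.find hb then w a i * ((σ i : ℤ) : ℝ) else 0 := by
      rw [← Finset.sum_add_distrib, Finset.mul_sum, h1]
      refine Finset.sum_congr rfl fun i _ => ?_
      by_cases hi : h i ≤ Nat.find hb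
      · simp only [flip, if_pos hi]; ring
      · simp only [flip, if_neg hi]; push_cast; ring
    by_contra hcon
    simp only [Set.mem_union, Set.mem_preimage, not_or, hG, Set.mem_ofPred_eq, not_exists,
      not_le] at hcon
    have h2 := abs_add_le (∑ i, w a i * ((σ i : ℤ) : ℝ)) (∑ i, w a i * ((φ σ i : ℤ) : ℝ))
    rw [hsum, abs_mul, abs_two] at h2
    linarith [hcon.1 a, hcon.2 a]
  have hle : (φ ⁻¹' G).ncard ≤ G.ncard :=
    Set.ncard_le_ncard_of_injOn φ (fun σ hσ => hσ) hφ.injective.injOn (Set.toFinite G)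
  have h1 := Set.ncard_le_ncard hsub (Set.toFinite (G ∪ φ ⁻¹' G))
  have h2 := Set.ncard_union_le G (φ ⁻¹' G)
  omega

/-- Peel off one coordinate at a time: Lévy's inequality removes the threshold on coordinate 0, with
the orthants in the remaining coordinates as its family `𝒜`. Each coordinate costs a factor 2,
however many thresholds there are. -/
theorem ncard_exists_orthant_le {m : ℕ} (w : ι → ℝ) (h : Fin m → ι → ℕ) (x : ℝ) :
    {σ : ι → ℤˣ | ∃ b : Fin m → ℕ,
        x ≤ |∑ i, if ∀ j, h j i ≤ b j then w i * ((σ i : ℤ) : ℝ) else 0|}.ncard ≤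
      2 ^ m * {σ : ι → ℤˣ | x ≤ |∑ i, w i * ((σ i : ℤ) : ℝ)|}.ncard := by
  induction m with
  | zero => simp
  | succ m ih =>
    have h1 := ncard_exists_threshold_le
      (fun (b : Fin m → ℕ) i => if ∀ j : Fin m, h j.succ i ≤ b j then w i else 0) (h 0) x
    have h2 := ih (fun j => h j.succ)
    simp only [ite_mul, zero_mul] at h1
    refine (Set.ncard_le_ncard (t := {σ : ι → ℤˣ | ∃ (b : Fin m → ℕ) (c : ℕ), x ≤ |∑ i,
      if h 0 i ≤ c then if ∀ j : Fin m, h j.succ i ≤ b j then w i * ((σ i : ℤ) : ℝ) else 0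
        else 0|}) ?_ (Set.toFinite _)).trans
      (h1.trans ((Nat.mul_le_mul_left 2 h2).trans_eq (by ring)))
    rintro σ ⟨b, hb⟩
    refine ⟨fun j => b j.succ, b 0, hb.trans_eq ?_⟩
    congr 1
    refine Finset.sum_congr rfl fun i _ => ?_
    simp only [Fin.forall_fin_succ, ite_and]

theorem sum_exp_rademacher_le [DecidableEq ι] (l : ℝ) :
    ∑ σ : ι → ℤˣ, Real.exp (l * ∑ i, ((σ i : ℤ) : ℝ)) ≤
      2 ^ Fintype.card ι * Real.exp (Fintype.card ι * (l ^ 2 / 2)) := by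
  classical
  have h1 : ∀ σ : ι → ℤˣ, Real.exp (l * ∑ i, ((σ i : ℤ) : ℝ)) =
      ∏ i, Real.exp (l * ((σ i : ℤ) : ℝ)) := by
    intro σ
    rw [Finset.mul_sum, Real.exp_sum]
  have h2 : ∑ s : ℤˣ, Real.exp (l * ((s : ℤ) : ℝ)) = 2 * Real.cosh l := by
    have : (Finset.univ : Finset ℤˣ) = {1, -1} := rfl
    rw [this, Finset.sum_pair (by decide), Real.cosh_eq]
    simp
    ring
  simp only [h1]
  rw [← Fintype.prod_sum (fun (_ : ι) (s : ℤˣ) => Real.exp (l * ((s : ℤ) : ℝ)))]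
  rw [Finset.prod_const, h2, mul_pow, Finset.card_univ, Real.exp_nat_mul]
  gcongr
  exact Real.cosh_le_exp_half_sq l

/-- Hoeffding's inequality for a Rademacher sum. -/
theorem ncard_rademacher_le [Nonempty ι] {x : ℝ} (hx : 0 ≤ x) :
    ({σ : ι → ℤˣ | x ≤ |∑ i, ((σ i : ℤ) : ℝ)|}.ncard : ℝ) ≤
      2 ^ Fintype.card ι * (2 * Real.exp (-x ^ 2 / (2 * Fintype.card ι))) := by
  classical
  set n : ℝ := (Fintype.card ι : ℝ)
  have hn : 0 < n := by simp only [n]; exact_mod_cast Fintype.card_pos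
  -- The minimiser of n l²/2 - l x in the Chernoff bound.
  set l : ℝ := x / n
  have hl : 0 ≤ l := by positivity
  set E : Finset (ι → ℤˣ) := Finset.univ.filter fun σ => x ≤ |∑ i, ((σ i : ℤ) : ℝ)|
  have hE : {σ : ι → ℤˣ | x ≤ |∑ i, ((σ i : ℤ) : ℝ)|}.ncard = E.card := by
    rw [← Set.ncard_coe_finset]; simp [E]
  have h1 : (E.card : ℝ) * Real.exp (l * x) ≤
      2 * (2 ^ Fintype.card ι * Real.exp (n * (l ^ 2 / 2))) := by
    calc (E.card : ℝ) * Real.exp (l * x) = ∑ _σ ∈ E, Real.exp (l * x) := by simp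
      _ ≤ ∑ σ ∈ E, (Real.exp (l * ∑ i, ((σ i : ℤ) : ℝ)) +
            Real.exp (-l * ∑ i, ((σ i : ℤ) : ℝ))) := by
          refine Finset.sum_le_sum fun σ hσ => ?_
          have hσ' : x ≤ |∑ i, ((σ i : ℤ) : ℝ)| := (Finset.mem_filter.1 hσ).2
          rcases le_abs.1 hσ' with h | h
          · have : Real.exp (l * x) ≤ Real.exp (l * ∑ i, ((σ i : ℤ) : ℝ)) :=
              Real.exp_le_exp.2 (mul_le_mul_of_nonneg_left h hl)
            linarith [Real.exp_pos (-l * ∑ i, ((σ i : ℤ) : ℝ))]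
          · have : Real.exp (l * x) ≤ Real.exp (-l * ∑ i, ((σ i : ℤ) : ℝ)) :=
              Real.exp_le_exp.2 (by nlinarith)
            linarith [Real.exp_pos (l * ∑ i, ((σ i : ℤ) : ℝ))]
      _ ≤ ∑ σ : ι → ℤˣ, (Real.exp (l * ∑ i, ((σ i : ℤ) : ℝ)) +
            Real.exp (-l * ∑ i, ((σ i : ℤ) : ℝ))) :=
          Finset.sum_le_sum_of_subset_of_nonneg (Finset.subset_univ _) fun _ _ _ => by positivity
      _ ≤ _ := by
          rw [Finset.sum_add_distrib]
          have ha := sum_exp_rademacher_le (ι := ι) l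
          have hb := sum_exp_rademacher_le (ι := ι) (-l)
          rw [neg_sq] at hb
          linarith
  rw [hE]
  have h2 : (E.card : ℝ) ≤
      2 * (2 ^ Fintype.card ι * Real.exp (n * (l ^ 2 / 2))) * Real.exp (-(l * x)) := by
    rw [Real.exp_neg, ← div_eq_mul_inv, le_div_iff₀ (Real.exp_pos _)]
    exact h1
  refine h2.trans_eq ?_
  have h3 : Real.exp (n * (l ^ 2 / 2)) * Real.exp (-(l * x)) = Real.exp (-x ^ 2 / (2 * n)) := by
    rw [← Real.exp_add]
    congr 1
    simp only [l]
    field_simp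
    ring
  rw [← h3]
  ring

end Rademacher

/-! ### Symmetrization -/

section Symmetrization

variable {α : Type*} [MeasurableSpace α] {n : ℕ}

open ProbabilityTheory

/-- The number of entries of `D` that lie in `A`. -/
noncomputable def hitCount (A : Set α) (D : Fin n → α) : ℝ :=
  ∑ i, A.indicator (fun _ => (1 : ℝ)) (D i)

theorem measurable_hitCount {A : Set α} (hA : MeasurableSet A) :
    Measurable (hitCount A : (Fin n → α) → ℝ) :=
  Finset.measurable_sum _ fun i _ =>
    (measurable_const.indicator hA).comp (measurable_pi_apply i)

variable (χ : Fin n → Measure α) [∀ i, IsProbabilityMeasure (χ i)]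

theorem integral_hitCount {A : Set α} (hA : MeasurableSet A) :
    ∫ D, hitCount A D ∂(Measure.pi χ) = ∑ i, (χ i).real A := by
  unfold hitCount
  rw [integral_finsetSum]
  · refine Finset.sum_congr rfl fun i _ => ?_
    rw [integral_comp_eval (μ := χ) (f := A.indicator fun _ => (1 : ℝ))]
    · rw [integral_indicator_const _ hA]; simp
    · exact (measurable_const.indicator hA).aestronglyMeasurable
  · intro i _
    refine Integrable.of_bound (C := 1) ?_ (.of_forall fun D => ?_)
    · exact ((measurable_const.indicator hA).comp (measurable_pi_apply i)).aestronglyMeasurable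
    · by_cases h : D i ∈ A <;> simp [h]

theorem variance_hitCount_le {A : Set α} (hA : MeasurableSet A) :
    Var[hitCount A; Measure.pi χ] ≤ n / 4 := by
  have hm : Measurable (A.indicator fun _ => (1 : ℝ)) := measurable_const.indicator hA
  have hb : ∀ p, A.indicator (fun _ => (1 : ℝ)) p ∈ Set.Icc (0 : ℝ) 1 := fun p => by
    by_cases h : p ∈ A <;> simp [h]
  have h1 : Var[∑ i, fun D : Fin n → α => A.indicator (fun _ => (1 : ℝ)) (D i); Measure.pi χ] =
      ∑ i, Var[A.indicator fun _ => (1 : ℝ); χ i] :=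
    variance_sum_pi fun i => memLp_of_bounded (.of_forall hb) hm.aestronglyMeasurable 2
  have h2 : (hitCount A : (Fin n → α) → ℝ) =
      ∑ i, fun D : Fin n → α => A.indicator (fun _ => (1 : ℝ)) (D i) := by
    funext D; simp [hitCount]
  rw [h2, h1]
  calc _ ≤ ∑ _i : Fin n, (1 / 4 : ℝ) := Finset.sum_le_sum fun i _ => by
          refine (variance_le_sq_of_bounded (.of_forall hb) hm.aemeasurable).trans ?_
          norm_num
    _ = n / 4 := by simp; ring

/-- Replacing the mean by an independent copy. -/
theorem measure_deviation_le_two_mul {𝓑 : Type*} [Finite 𝓑] (A : 𝓑 → Set α)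
    (hA : ∀ b, MeasurableSet (A b)) {x : ℝ} (hx : 0 < x) (hxn : 2 * n ≤ x ^ 2) :
    Measure.pi χ {D | ∃ b, x ≤ |hitCount (A b) D - ∑ i, (χ i).real (A b)|} ≤
      2 * ((Measure.pi χ).prod (Measure.pi χ))
        {W | ∃ b, x / 2 ≤ |hitCount (A b) W.1 - hitCount (A b) W.2|} := by
  set μ := Measure.pi χ
  have hms : MeasurableSet {W : (Fin n → α) × (Fin n → α) |
      ∃ b, x / 2 ≤ |hitCount (A b) W.1 - hitCount (A b) W.2|} := by
    rw [Set.ofPred_exists]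
    refine MeasurableSet.iUnion fun b => measurableSet_le measurable_const ?_
    have := measurable_hitCount (n := n) (hA b)
    exact ((this.comp measurable_fst).sub (this.comp measurable_snd)).abs
  have hms1 : MeasurableSet {D : Fin n → α |
      ∃ b, x ≤ |hitCount (A b) D - ∑ i, (χ i).real (A b)|} := by
    rw [Set.ofPred_exists]
    exact MeasurableSet.iUnion fun b => measurableSet_le measurable_const
      ((measurable_hitCount (hA b)).sub_const _).abs
  rw [Measure.prod_apply hms]
  have key : ∀ D ∈ {D : Fin n → α | ∃ b, x ≤ |hitCount (A b) D - ∑ i, (χ i).real (A b)|},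
      (1 : ENNReal) ≤ 2 * μ (Prod.mk D ⁻¹'
        {W | ∃ b, x / 2 ≤ |hitCount (A b) W.1 - hitCount (A b) W.2|}) := by
    rintro D ⟨b, hb⟩
    -- Chebyshev: the variance is at most n/4, while (x/2)² ≥ n/2. So with probability at least 1/2
    -- the independent copy stays within x/2 of the mean at this same b.
    have hcheb : μ {D' | x / 2 ≤ |hitCount (A b) D' - ∑ i, (χ i).real (A b)|} ≤ 1 / 2 := by
      have hm : MemLp (hitCount (A b)) 2 μ := by
        refine MemLp.of_bound (measurable_hitCount (hA b)).aestronglyMeasurable (∑ _i : Fin n, 1)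
          (.of_forall fun D => ?_)
        refine (norm_sum_le _ _).trans (Finset.sum_le_sum fun i _ => ?_)
        by_cases h : D i ∈ A b <;> simp [h]
      have h1 := meas_ge_le_variance_div_sq hm (half_pos hx)
      rw [integral_hitCount χ (hA b)] at h1
      refine h1.trans ?_
      rw [show (1 / 2 : ENNReal) = ENNReal.ofReal (1 / 2) by
        rw [ENNReal.ofReal_div_of_pos two_pos]; simp]
      refine ENNReal.ofReal_le_ofReal ?_
      rw [div_le_iff₀ (by positivity)]
      have := variance_hitCount_le χ (hA b)
      nlinarith
    have hsub : (Set.univ : Set (Fin n → α)) ⊆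
        {D' | x / 2 ≤ |hitCount (A b) D' - ∑ i, (χ i).real (A b)|} ∪ (Prod.mk D ⁻¹'
        {W | ∃ b, x / 2 ≤ |hitCount (A b) W.1 - hitCount (A b) W.2|}) := by
      intro D' _
      by_cases h : x / 2 ≤ |hitCount (A b) D' - ∑ i, (χ i).real (A b)|
      · exact Or.inl h
      · refine Or.inr ⟨b, ?_⟩
        have := abs_sub_le (hitCount (A b) D) (hitCount (A b) D') (∑ i, (χ i).real (A b))
        simp only at this ⊢
        linarith
    have h3 := (measure_mono hsub).trans (measure_union_le (μ := μ) _ _)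
    rw [measure_univ] at h3
    have h4 : (1 : ENNReal) / 2 ≤ μ (Prod.mk D ⁻¹'
        {W | ∃ b, x / 2 ≤ |hitCount (A b) W.1 - hitCount (A b) W.2|}) := by
      refine (ENNReal.add_le_add_iff_left (a := 1 / 2) (by simp)).1 ?_
      rw [ENNReal.add_halves]
      exact h3.trans (add_le_add_left hcheb _)
    calc (1 : ENNReal) = 2 * (1 / 2) := by
          rw [one_div, ENNReal.mul_inv_cancel two_ne_zero ENNReal.ofNat_ne_top]
      _ ≤ _ := by gcongr
  rw [← lintegral_const_mul' _ _ ENNReal.ofNat_ne_top]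
  calc _ = ∫⁻ D in {D | ∃ b, x ≤ |hitCount (A b) D - ∑ i, (χ i).real (A b)|}, 1 ∂μ := by simp
    _ ≤ _ := setLIntegral_mono' hms1 key
    _ ≤ _ := setLIntegral_le_lintegral _ _

/-- Exchanging a record with its independent copy preserves the joint law. -/
theorem measurePreserving_swapAt (σ : Fin n → ℤˣ) :
    MeasurePreserving (fun (W : (Fin n → α) × (Fin n → α)) =>
        ((fun i => if σ i = 1 then W.1 i else W.2 i, fun i => if σ i = 1 then W.2 i else W.1 i) :
          (Fin n → α) × (Fin n → α)))
      ((Measure.pi χ).prod (Measure.pi χ)) ((Measure.pi χ).prod (Measure.pi χ)) := by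
  have e := measurePreserving_arrowProdEquivProdArrow α α (Fin n) χ χ
  have hs : MeasurePreserving
      (fun (V : Fin n → α × α) i => if σ i = 1 then V i else (V i).swap)
      (Measure.pi fun i => (χ i).prod (χ i)) (Measure.pi fun i => (χ i).prod (χ i)) := by
    refine measurePreserving_pi (fun i => (χ i).prod (χ i)) (fun i => (χ i).prod (χ i))
      (f := fun i v => if σ i = 1 then v else v.swap) fun i => ?_
    by_cases h : σ i = 1
    · simpa [h] using! MeasurePreserving.id _
    · simpa [h] using Measure.measurePreserving_swap
  have := (e.comp hs).comp e.symm
  convert this using 1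
  funext W
  ext i <;> by_cases h : σ i = 1 <;> simp [h, MeasurableEquiv.arrowProdEquivProdArrow,
    Equiv.arrowProdEquivProdArrow]

/-- Symmetrization: a bound on the Rademacher maxima that holds for all data bounds the deviations
of the empirical counts from their means. -/
theorem measure_deviation_le_of_rademacher {𝓑 : Type*} [Finite 𝓑] (A : 𝓑 → Set α)
    (hA : ∀ b, MeasurableSet (A b)) {x R : ℝ} (hx : 0 < x) (hxn : 2 * n ≤ x ^ 2)
    (hR : ∀ D : Fin n → α, ({σ : Fin n → ℤˣ | ∃ b, x / 4 ≤
      |∑ i, (A b).indicator (fun _ => (1 : ℝ)) (D i) * ((σ i : ℤ) : ℝ)|}.ncard : ℝ) ≤ 2 ^ n * R) :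
    Measure.pi χ {D | ∃ b, x ≤ |hitCount (A b) D - ∑ i, (χ i).real (A b)|} ≤
      ENNReal.ofReal (4 * R) := by
  classical
  set μ := Measure.pi χ
  set E : (Fin n → ℤˣ) → Set ((Fin n → α) × (Fin n → α)) := fun σ =>
    {W | ∃ b, x / 2 ≤ |∑ i, ((A b).indicator (fun _ => (1 : ℝ)) (W.1 i) -
      (A b).indicator (fun _ => (1 : ℝ)) (W.2 i)) * ((σ i : ℤ) : ℝ)|} with hE
  have hEm : ∀ σ, MeasurableSet (E σ) := by
    intro σ
    simp only [hE, Set.ofPred_exists]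
    refine MeasurableSet.iUnion fun b => measurableSet_le measurable_const ?_
    refine (Finset.measurable_sum _ fun i _ => ?_).abs
    have hm : Measurable ((A b).indicator fun _ => (1 : ℝ)) := measurable_const.indicator (hA b)
    exact ((hm.comp ((measurable_pi_apply i).comp measurable_fst)).sub
      (hm.comp ((measurable_pi_apply i).comp measurable_snd))).mul_const _
  -- A sign -1 at i amounts to exchanging record i with its copy, so all the events E σ have the
  -- same probability and may be averaged over σ.
  have hswap : ∀ σ, (μ.prod μ) (E σ) = (μ.prod μ)
      {W | ∃ b, x / 2 ≤ |hitCount (A b) W.1 - hitCount (A b) W.2|} := by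
    intro σ
    have h1 : {W : (Fin n → α) × (Fin n → α) | ∃ b, x / 2 ≤
        |hitCount (A b) W.1 - hitCount (A b) W.2|} = E 1 := by
      ext W
      simp [hE, hitCount]
    rw [h1, ← (measurePreserving_swapAt χ σ).measure_preimage (hEm 1).nullMeasurableSet]
    congr 1
    ext W
    simp only [hE, Set.mem_ofPred_eq, Set.mem_preimage]
    refine exists_congr fun b => ?_
    have : ∀ i, ((A b).indicator (fun _ => (1 : ℝ)) (W.1 i) -
        (A b).indicator (fun _ => (1 : ℝ)) (W.2 i)) * ((σ i : ℤ) : ℝ) =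
        ((A b).indicator (fun _ => (1 : ℝ)) (if σ i = 1 then W.1 i else W.2 i) -
        (A b).indicator (fun _ => (1 : ℝ)) (if σ i = 1 then W.2 i else W.1 i)) *
          ((((1 : Fin n → ℤˣ) i : ℤˣ) : ℤ) : ℝ) := by
      intro i
      rcases Int.units_eq_one_or (σ i) with h | h
      · simp [h]
      · have : (-1 : ℤˣ) ≠ 1 := by decide
        simp [h, this]
    simp only [this]
  -- For fixed data only the signs are random. A signed difference of size x/2 forces a signed sum
  -- of size x/4 for one of the two samples, hence the factor 2.
  have hcount : ∀ W : (Fin n → α) × (Fin n → α),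
      ((Finset.univ.filter fun σ => W ∈ E σ).card : ℝ) ≤ 2 ^ n * (2 * R) := by
    intro W
    have hsub : {σ : Fin n → ℤˣ | W ∈ E σ} ⊆
        {σ | ∃ b, x / 4 ≤ |∑ i, (A b).indicator (fun _ => (1 : ℝ)) (W.1 i) * ((σ i : ℤ) : ℝ)|} ∪
        {σ | ∃ b, x / 4 ≤
          |∑ i, (A b).indicator (fun _ => (1 : ℝ)) (W.2 i) * ((σ i : ℤ) : ℝ)|} := by
      rintro σ ⟨b, hb⟩
      simp only [sub_mul, Finset.sum_sub_distrib] at hb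
      by_contra hcon
      simp only [Set.mem_union, Set.mem_ofPred_eq, not_or, not_exists, not_le] at hcon
      have := abs_sub (∑ i, (A b).indicator (fun _ => (1 : ℝ)) (W.1 i) * ((σ i : ℤ) : ℝ))
        (∑ i, (A b).indicator (fun _ => (1 : ℝ)) (W.2 i) * ((σ i : ℤ) : ℝ))
      linarith [hcon.1 b, hcon.2 b]
    have h1 := (Set.ncard_le_ncard hsub (Set.toFinite _)).trans (Set.ncard_union_le _ _)
    have h2 : {σ : Fin n → ℤˣ | W ∈ E σ}.ncard =
        (Finset.univ.filter fun σ => W ∈ E σ).card := by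
      rw [← Set.ncard_coe_finset]; simp
    rw [h2] at h1
    have h3 : ((Finset.univ.filter fun σ => W ∈ E σ).card : ℝ) ≤ _ := Nat.cast_le.2 h1
    push_cast at h3
    linarith [hR W.1, hR W.2]
  have hsum : (2 : ENNReal) ^ n * (μ.prod μ)
      {W | ∃ b, x / 2 ≤ |hitCount (A b) W.1 - hitCount (A b) W.2|} ≤
      2 ^ n * ENNReal.ofReal (2 * R) := by
    calc _ = ∑ σ, (μ.prod μ) (E σ) := by
          simp [hswap]
      _ = ∑ σ, ∫⁻ W, (E σ).indicator 1 W ∂(μ.prod μ) := by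
          simp [lintegral_indicator_one (hEm _)]
      _ = ∫⁻ W, ∑ σ, (E σ).indicator 1 W ∂(μ.prod μ) := by
          rw [lintegral_finsetSum]
          exact fun σ _ => measurable_one.indicator (hEm σ)
      _ ≤ ∫⁻ _, 2 ^ n * ENNReal.ofReal (2 * R) ∂(μ.prod μ) := by
          refine lintegral_mono fun W => ?_
          have : (∑ σ, (E σ).indicator 1 W : ENNReal) =
              ((Finset.univ.filter fun σ => W ∈ E σ).card : ENNReal) := by
            simp [Set.indicator_apply]
          rw [this, ← ENNReal.ofReal_natCast]
          refine (ENNReal.ofReal_le_ofReal (hcount W)).trans_eq ?_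
          rw [ENNReal.ofReal_mul (by positivity), ENNReal.ofReal_pow (by norm_num)]
          simp
      _ = _ := by simp
  have hfin := (ENNReal.mul_le_mul_iff_right (by positivity) (by simp)).1 hsum
  calc _ ≤ _ := measure_deviation_le_two_mul χ A hA hx hxn
    _ ≤ 2 * ENNReal.ofReal (2 * R) := by gcongr
    _ = _ := by
      rw [show (2 : ENNReal) = ENNReal.ofReal 2 by simp, ← ENNReal.ofReal_mul (by norm_num)]
      ring_nf

/-- Uniform deviation bound for the counts of a class of orthants. -/
theorem measure_orthant_deviation_le {m k : ℕ} (h : Fin m → α → ℕ) (hh : ∀ j, Measurable (h j))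
    {x : ℝ} (hn : 0 < n) (hx : 0 < x) (hxn : 2 * n ≤ x ^ 2) :
    Measure.pi χ {D | ∃ b : Fin m → Fin k,
        x ≤ |hitCount {p | ∀ j, h j p ≤ b j} D - ∑ i, (χ i).real {p | ∀ j, h j p ≤ b j}|} ≤
      ENNReal.ofReal (8 * 2 ^ m * Real.exp (-x ^ 2 / (32 * n))) := by
  have : Nonempty (Fin n) := ⟨⟨0, hn⟩⟩
  have hmeas : ∀ b : Fin m → Fin k, MeasurableSet {p : α | ∀ j, h j p ≤ b j} := by
    intro b
    rw [Set.ofPred_forall]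
    exact MeasurableSet.iInter fun j => hh j measurableSet_Iic
  refine (measure_deviation_le_of_rademacher χ (fun b : Fin m → Fin k => {p | ∀ j, h j p ≤ b j})
    hmeas hx hxn (R := 2 ^ m * (2 * Real.exp (-x ^ 2 / (32 * n)))) fun D => ?_).trans_eq ?_
  · have h1 := ncard_exists_orthant_le (fun _ : Fin n => (1 : ℝ)) (fun j i => h j (D i)) (x / 4)
    have h2 := ncard_rademacher_le (ι := Fin n) (x := x / 4) (by positivity)
    simp only [one_mul] at h1
    have h3 : {σ : Fin n → ℤˣ | ∃ b : Fin m → Fin k, x / 4 ≤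
        |∑ i, {p | ∀ j, h j p ≤ b j}.indicator (fun _ => (1 : ℝ)) (D i) * ((σ i : ℤ) : ℝ)|} ⊆
        {σ | ∃ b : Fin m → ℕ,
          x / 4 ≤ |∑ i, if ∀ j, h j (D i) ≤ b j then ((σ i : ℤ) : ℝ) else 0|} := by
      rintro σ ⟨b, hb⟩
      refine ⟨fun j => b j, hb.trans_eq ?_⟩
      congr 1
      refine Finset.sum_congr rfl fun i _ => ?_
      simp [Set.indicator_apply]
    have h4 := (Set.ncard_le_ncard h3 (Set.toFinite _)).trans h1
    calc _ ≤ ((2 ^ m * {σ : Fin n → ℤˣ | x / 4 ≤ |∑ i, ((σ i : ℤ) : ℝ)|}.ncard : ℕ) : ℝ) :=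
          Nat.cast_le.2 h4
      _ = 2 ^ m * ({σ : Fin n → ℤˣ | x / 4 ≤ |∑ i, ((σ i : ℤ) : ℝ)|}.ncard : ℝ) := by push_cast; rfl
      _ ≤ 2 ^ m * _ := mul_le_mul_of_nonneg_left h2 (by positivity)
      _ = _ := by
        rw [Fintype.card_fin, show -(x / 4) ^ 2 / (2 * (n : ℝ)) = -x ^ 2 / (32 * n) by
          field_simp; ring]
        ring
  · congr 1
    ring

end Symmetrization

/-! ### Distributions with a bounded gradient -/

section BoundedGradient

variable {d n : ℕ}

theorem measurableSet_queryBox (q : RangeQuery d) : MeasurableSet (queryBox q) := by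
  have : queryBox q = ⋂ i, {p : DataPoint d | q (Sum.inl i) ≤ (p i : ℝ)} ∩
      {p | (p i : ℝ) ≤ q (Sum.inl i) + q (Sum.inr i)} := by
    ext p; simp [queryBox]
  rw [this]
  have hm : ∀ i, Measurable fun p : DataPoint d => (p i : ℝ) := fun i =>
    measurable_subtype_coe.comp (measurable_pi_apply i)
  exact MeasurableSet.iInter fun i =>
    (measurableSet_le measurable_const (hm i)).inter (measurableSet_le (hm i) measurable_const)

theorem cardinalityFn_eq_hitCount (D : Dataset d n) (q : RangeQuery d) :
    cardinalityFn D q = hitCount (queryBox q) D := by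
  classical
  unfold cardinalityFn hitCount
  rw [Nat.card_eq_fintype_card, Fintype.card_subtype]
  simp [Set.indicator_apply]

theorem distCardinalityFn_eq_sum (χ : Fin n → ProbabilityMeasure (DataPoint d))
    (q : RangeQuery d) : distCardinalityFn χ q = ∑ i, matchProb (χ i) q := by
  unfold distCardinalityFn samplingLaw
  simp only [cardinalityFn_eq_hitCount]
  rw [integral_hitCount _ (measurableSet_queryBox q)]
  rfl

/-- The query that restricts only the `j`-th attribute, to the interval `[a, a + s]`. -/
noncomputable def slabQuery (j : Fin d) (a s : ℝ) : RangeQuery d :=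
  WithLp.toLp 2 (Sum.elim (fun i => if i = j then a else 0) fun i => if i = j then s else 1)

theorem slabQuery_mem {j : Fin d} {a s : ℝ} (ha : 0 ≤ a) (hs : 0 ≤ s) (has : a + s ≤ 1) :
    slabQuery j a s ∈ innerQueryDomain d := by
  intro i
  by_cases h : i = j <;> simp [slabQuery, h, ha, hs, has]

theorem queryBox_slabQuery (j : Fin d) (a s : ℝ) :
    queryBox (slabQuery j a s) = {p | a ≤ (p j : ℝ) ∧ (p j : ℝ) ≤ a + s} := by
  ext p
  simp only [queryBox, slabQuery, Sum.elim_inl, Sum.elim_inr, Set.mem_ofPred_eq]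
  refine ⟨fun h => by simpa using h j, fun h i => ?_⟩
  by_cases hi : i = j
  · subst hi; simpa using h
  · simp only [hi, if_false, zero_add]
    exact (p i).2

theorem convex_innerQueryDomain : Convex ℝ (innerQueryDomain d) := by
  intro x hx y hy a b ha hb hab i
  obtain ⟨h1, h2, h3⟩ := hx i
  obtain ⟨h4, h5, h6⟩ := hy i
  simp only [PiLp.add_apply, PiLp.smul_apply, smul_eq_mul]
  refine ⟨by positivity, by positivity, ?_⟩
  nlinarith

variable {ρ : ℝ} {μ : ProbabilityMeasure (DataPoint d)}

theorem abs_matchProb_sub_le (hμ : μ ∈ boundedGradientClass d ρ) {q q' : RangeQuery d}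
    (hq : q ∈ innerQueryDomain d) (hq' : q' ∈ innerQueryDomain d) :
    |matchProb μ q' - matchProb μ q| ≤ ρ * ‖q' - q‖ := by
  have h : ∀ x : RangeQuery d, ∃ v : RangeQuery d, x ∈ innerQueryDomain d →
      HasGradientWithinAt (matchProb μ) v (innerQueryDomain d) x ∧ ‖v‖ ≤ ρ := by
    intro x
    by_cases hx : x ∈ innerQueryDomain d
    · obtain ⟨v, hv⟩ := hμ x hx
      exact ⟨v, fun _ => hv⟩
    · exact ⟨0, fun h => absurd h hx⟩
  choose v hv using h
  refine convex_innerQueryDomain.norm_image_sub_le_of_norm_hasFDerivWithin_le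
    (f' := fun x => InnerProductSpace.toDual ℝ (RangeQuery d) (v x)) (fun x hx => (hv x hx).1)
    (fun x hx => ?_) hq hq'
  rw [LinearIsometryEquiv.norm_map]
  exact (hv x hx).2

/-- A distribution with bounded gradient has no atoms in any coordinate. -/
theorem measureReal_coord_eq_zero (hμ : μ ∈ boundedGradientClass d ρ) (j : Fin d) {a : ℝ}
    (ha : a ∈ Set.Icc (0 : ℝ) 1) :
    (μ : Measure (DataPoint d)).real {p | (p j : ℝ) = a} = 0 := by
  set f : DataPoint d → ℝ := fun p => (p j : ℝ) with hf
  have hfm : Measurable f := measurable_subtype_coe.comp (measurable_pi_apply j)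
  have hslab : ∀ x, matchProb μ (slabQuery j x 0) =
      (μ : Measure (DataPoint d)).real {p | (p j : ℝ) = x} := by
    intro x
    simp only [matchProb, queryBox_slabQuery, add_zero, ← le_antisymm_iff, eq_comm]
  have hρ : 0 ≤ ρ := by
    obtain ⟨v, -, hv⟩ := hμ (slabQuery j a 0) (slabQuery_mem ha.1 le_rfl (by simpa using ha.2))
    exact (norm_nonneg v).trans hv
  have hcount : {x : ℝ | 0 < (μ : Measure (DataPoint d)) {p | f p = x}}.Countable :=
    Measure.countable_meas_level_set_pos hfm
  -- The mass of the hyperplane p_j = x is ρ-Lipschitz in x and vanishes for all but countably many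
  -- x, so it vanishes at points arbitrarily close to a.
  have hle : ∀ δ > 0, (μ : Measure (DataPoint d)).real {p | (p j : ℝ) = a} ≤ ρ * δ := by
    intro δ hδ
    have hne : (max 0 (a - δ)) < min 1 (a + δ) := by
      simp only [max_lt_iff, lt_min_iff]
      have h0 := ha.1
      have h1 := ha.2
      refine ⟨⟨?_, ?_⟩, ?_, ?_⟩ <;> linarith
    obtain ⟨x, hx, hx1⟩ := (hcount.dense_compl ℝ).exists_mem_open isOpen_Ioo
      (Set.nonempty_Ioo.2 hne)
    simp only [Set.mem_Ioo, max_lt_iff, lt_min_iff] at hx1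
    have hx0 : (μ : Measure (DataPoint d)).real {p | (p j : ℝ) = x} = 0 := by
      have : (μ : Measure (DataPoint d)) {p | f p = x} = 0 := by
        simpa [pos_iff_ne_zero] using hx
      exact (measureReal_eq_zero_iff).2 this
    have h1 := abs_matchProb_sub_le hμ (q := slabQuery j x 0) (q' := slabQuery j a 0)
      (slabQuery_mem hx1.1.1.le le_rfl (by linarith [hx1.2.1]))
      (slabQuery_mem ha.1 le_rfl (by simpa using ha.2))
    have h2 : slabQuery j a 0 - slabQuery j x 0 = EuclideanSpace.single (Sum.inl j) (a - x) := by
      ext k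
      rcases k with k | k <;> by_cases hk : k = j <;> simp [slabQuery, hk]
    rw [hslab, hslab, hx0, sub_zero, h2, PiLp.norm_single] at h1
    refine (le_abs_self _).trans (h1.trans (mul_le_mul_of_nonneg_left ?_ hρ))
    rw [Real.norm_eq_abs, abs_le]
    constructor <;> linarith [hx1.1.2, hx1.2.2]
  refine le_antisymm (le_of_forall_pos_le_add fun ε hε => ?_) measureReal_nonneg
  have h1 := hle (ε / (ρ + 1)) (by positivity)
  have h2 : ρ * (ε / (ρ + 1)) ≤ ε := by
    rw [mul_div_assoc', div_le_iff₀ (by positivity)]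
    nlinarith
  linarith

/-- Let r_j grow from 0 to b - a. The degenerate slab at the start has no mass, since there are no
atoms in coordinate j, and the gradient bound controls the increase. -/
theorem measureReal_slab_le (hμ : μ ∈ boundedGradientClass d ρ) (j : Fin d) {a b : ℝ}
    (ha : 0 ≤ a) (hab : a ≤ b) (hb : b ≤ 1) :
    (μ : Measure (DataPoint d)).real {p | a ≤ (p j : ℝ) ∧ (p j : ℝ) ≤ b} ≤ ρ * (b - a) := by
  have h1 := abs_matchProb_sub_le hμ (q := slabQuery j a 0) (q' := slabQuery j a (b - a))
    (slabQuery_mem ha le_rfl (by linarith)) (slabQuery_mem ha (by linarith) (by linarith))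
  have h2 : slabQuery j a (b - a) - slabQuery j a 0 =
      EuclideanSpace.single (Sum.inr j) (b - a) := by
    ext k
    rcases k with k | k <;> by_cases hk : k = j <;> simp [slabQuery, hk]
  rw [h2, PiLp.norm_single, Real.norm_of_nonneg (by linarith)] at h1
  simp only [matchProb, queryBox_slabQuery, add_zero, ← le_antisymm_iff,
    add_sub_cancel] at h1
  have h3 := measureReal_coord_eq_zero hμ j (a := a) ⟨ha, hab.trans hb⟩
  simp only [eq_comm (b := a)] at h3
  rw [h3, sub_zero] at h1
  exact (le_abs_self _).trans h1

/-- The whole cube is a slab of width 1. For n ≥ 2 this gives 2 ≤ ρ²n, so that even a grid with a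
single cell meets the cost bound. -/
theorem one_le_of_mem_boundedGradientClass (hd : 0 < d) (hμ : μ ∈ boundedGradientClass d ρ) :
    1 ≤ ρ := by
  have h := measureReal_slab_le hμ ⟨0, hd⟩ (a := 0) (b := 1) le_rfl zero_le_one le_rfl
  have h1 : {p : DataPoint d | 0 ≤ (p ⟨0, hd⟩ : ℝ) ∧ (p ⟨0, hd⟩ : ℝ) ≤ 1} = Set.univ := by
    ext p
    simp only [Set.mem_ofPred_eq, Set.mem_univ, iff_true]
    exact (p ⟨0, hd⟩).2
  rw [h1] at h
  simpa using h

end BoundedGradient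

/-! ### Rounding to a grid -/

section Grid

variable {d n : ℕ}

/-- The index of the cell of the grid of mesh `1 / k` on `[0, 1]` that contains `x`; points beyond
`1` belong to the last cell. -/
noncomputable def gridCell (k : ℕ) (x : ℝ) : ℕ := min ⌊k * x⌋₊ (k - 1)

theorem gridCell_mono (k : ℕ) : Monotone (gridCell k) := fun x y h => by
  unfold gridCell
  gcongr

theorem gridCell_lt {k : ℕ} (hk : 0 < k) (x : ℝ) : gridCell k x < k := by
  unfold gridCell
  omega

theorem measurable_gridCell (k : ℕ) : Measurable (gridCell k) :=
  (gridCell_mono k).measurable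

theorem gridCell_le_mul {k : ℕ} {x : ℝ} (hx : 0 ≤ x) : (gridCell k x : ℝ) ≤ k * x := by
  refine le_trans ?_ (Nat.floor_le (by positivity : (0 : ℝ) ≤ k * x))
  exact_mod_cast min_le_left _ _

theorem mul_le_gridCell_add_one {k : ℕ} (hk : 0 < k) {x : ℝ} (hx : x ≤ 1) :
    k * x ≤ gridCell k x + 1 := by
  unfold gridCell
  rcases le_total ⌊k * x⌋₊ (k - 1) with h | h
  · rw [min_eq_left h]
    exact (Nat.lt_floor_add_one _).le
  · rw [min_eq_right h]
    have : ((k - 1 : ℕ) : ℝ) + 1 = k := by exact_mod_cast Nat.sub_add_cancel hk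
    rw [this]
    nlinarith [(Nat.cast_pos (α := ℝ)).2 hk]

/-- The grid coordinates of a record: those of its upper and its reflected lower orthant. -/
noncomputable def recordDigit (k : ℕ) (j : Fin (d + d)) (p : DataPoint d) : ℕ :=
  Fin.addCases (fun i => gridCell k (p i)) (fun i => k - 1 - gridCell k (p i)) j

/-- The grid coordinates of a query. -/
noncomputable def queryDigit (k : ℕ) (q : RangeQuery d) (j : Fin (d + d)) : ℕ :=
  Fin.addCases (fun i => gridCell k (q (Sum.inl i) + q (Sum.inr i)))
    (fun i => k - 1 - gridCell k (q (Sum.inl i))) j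

theorem queryDigit_lt {k : ℕ} (hk : 0 < k) (q : RangeQuery d) (j : Fin (d + d)) :
    queryDigit k q j < k := by
  induction j using Fin.addCases with
  | left i => simpa [queryDigit] using gridCell_lt hk _
  | right i =>
    simp only [queryDigit, Fin.addCases_right]
    omega

theorem measurable_recordDigit (k : ℕ) (j : Fin (d + d)) :
    Measurable (recordDigit k j : DataPoint d → ℕ) := by
  have hm : ∀ i, Measurable fun p : DataPoint d => gridCell k (p i) := fun i =>
    (measurable_gridCell k).comp (measurable_subtype_coe.comp (measurable_pi_apply i))
  induction j using Fin.addCases with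
  | left i =>
    have : recordDigit k (Fin.castAdd d i) = fun p : DataPoint d => gridCell k (p i) := by
      funext p; simp only [recordDigit, Fin.addCases_left]
    rw [this]
    exact hm i
  | right i =>
    have : recordDigit k (Fin.natAdd d i) = fun p : DataPoint d => k - 1 - gridCell k (p i) := by
      funext p; simp only [recordDigit, Fin.addCases_right]
    rw [this]
    exact (measurable_of_countable fun m : ℕ => k - 1 - m).comp (hm i)

/-- The set of records which the grid cannot distinguish from a record that matches `q`. -/
theorem setOf_recordDigit_le {k : ℕ} (hk : 0 < k) (q : RangeQuery d) :
    {p : DataPoint d | ∀ j, recordDigit k j p ≤ queryDigit k q j} =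
      {p | ∀ i, gridCell k (q (Sum.inl i)) ≤ gridCell k (p i) ∧
        gridCell k (p i) ≤ gridCell k (q (Sum.inl i) + q (Sum.inr i))} := by
  ext p
  simp only [Set.mem_ofPred_eq]
  have h1 := fun i => gridCell_lt hk (q (Sum.inl i))
  have h2 := fun i => gridCell_lt hk (p i)
  constructor
  · intro h i
    have ha := h (Fin.castAdd d i)
    have hb := h (Fin.natAdd d i)
    simp only [recordDigit, queryDigit, Fin.addCases_left, Fin.addCases_right] at ha hb
    refine ⟨?_, ha⟩
    have := h1 i
    have := h2 i
    omega
  · intro h j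
    induction j using Fin.addCases with
    | left i => simpa [recordDigit, queryDigit] using (h i).2
    | right i =>
      simp only [recordDigit, queryDigit, Fin.addCases_right]
      have := (h i).1
      omega

/-- The rounding error in probability. -/
theorem abs_matchProb_sub_grid_le {ρ : ℝ} {μ : ProbabilityMeasure (DataPoint d)}
    (hμ : μ ∈ boundedGradientClass d ρ) {k : ℕ} (hk : 0 < k) (q : RangeQuery d) :
    |matchProb μ q - (μ : Measure (DataPoint d)).real
        {p | ∀ j, recordDigit k j p ≤ queryDigit k q j}| ≤ 2 * d * (ρ / k) := by
  have hk' : (0 : ℝ) < k := Nat.cast_pos.2 hk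
  set A : Set (DataPoint d) := {p | ∀ j, recordDigit k j p ≤ queryDigit k q j} with hA
  have hcell : ∀ (j : Fin d) (m : ℕ), m < k →
      (μ : Measure (DataPoint d)).real {p | gridCell k (p j) = m} ≤ ρ / k := by
    intro j m hm
    have hm' : (m : ℝ) + 1 ≤ k := by exact_mod_cast hm
    have h1 := measureReal_slab_le hμ j (a := m / k) (b := (m + 1) / k) (by positivity)
      (by gcongr; linarith) ((div_le_one hk').2 hm')
    refine (measureReal_mono ?_).trans (h1.trans_eq (by field_simp; ring))
    intro p hp
    simp only [Set.mem_ofPred_eq] at hp ⊢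
    rw [div_le_iff₀ hk', le_div_iff₀ hk', mul_comm, ← hp]
    exact ⟨gridCell_le_mul (p j).2.1, mul_le_gridCell_add_one hk (p j).2.2⟩
  have hsub1 : queryBox q ⊆ A := by
    rw [hA, setOf_recordDigit_le hk]
    exact fun p hp i => ⟨gridCell_mono k (hp i).1, gridCell_mono k (hp i).2⟩
  -- A record that is wrongly included shares a cell, in some coordinate, with an endpoint of the
  -- query: 2d cells in all, each of mass at most ρ/k.
  have hsub2 : A ⊆ queryBox q ∪ ⋃ i : Fin d,
      ({p | gridCell k (p i) = gridCell k (q (Sum.inl i))} ∪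
        {p | gridCell k (p i) = gridCell k (q (Sum.inl i) + q (Sum.inr i))}) := by
    rw [hA, setOf_recordDigit_le hk]
    intro p hp
    by_cases hq : p ∈ queryBox q
    · exact Or.inl hq
    · right
      simp only [queryBox, Set.mem_ofPred_eq, not_forall, not_and_or, not_le] at hq
      obtain ⟨i, hi⟩ := hq
      refine Set.mem_iUnion.2 ⟨i, ?_⟩
      rcases hi with hi | hi
      · exact Or.inl (le_antisymm (gridCell_mono k hi.le) (hp i).1)
      · exact Or.inr (le_antisymm (hp i).2 (gridCell_mono k hi.le))
  have h1 : matchProb μ q ≤ (μ : Measure (DataPoint d)).real A := measureReal_mono hsub1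
  have h2 : (μ : Measure (DataPoint d)).real A ≤ matchProb μ q + 2 * d * (ρ / k) := by
    refine (measureReal_mono hsub2).trans ((measureReal_union_le _ _).trans ?_)
    refine add_le_add le_rfl ((measureReal_iUnion_fintype_le _).trans ?_)
    calc _ ≤ ∑ _i : Fin d, (ρ / k + ρ / k) := Finset.sum_le_sum fun i _ =>
          (measureReal_union_le _ _).trans
            (add_le_add (hcell i _ (gridCell_lt hk _)) (hcell i _ (gridCell_lt hk _)))
      _ = _ := by simp; ring
  rw [abs_le]
  constructor <;> linarith

/-- The expected count is approximated by the expected grid count. -/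
theorem abs_distCardinalityFn_sub_grid_le {ρ : ℝ} {χ : Fin n → ProbabilityMeasure (DataPoint d)}
    (hχ : ∀ i, χ i ∈ boundedGradientClass d ρ) {k : ℕ} (hk : 0 < k) (q : RangeQuery d) :
    |distCardinalityFn χ q - ∑ i, (χ i : Measure (DataPoint d)).real
        {p | ∀ j, recordDigit k j p ≤ queryDigit k q j}| ≤ n * (2 * d * (ρ / k)) := by
  rw [distCardinalityFn_eq_sum, ← Finset.sum_sub_distrib]
  refine (Finset.abs_sum_le_sum_abs _ _).trans ?_
  calc _ ≤ ∑ _i : Fin n, 2 * d * (ρ / k) :=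
        Finset.sum_le_sum fun i _ => abs_matchProb_sub_grid_le (hχ i) hk q
    _ = _ := by simp

/-- The accuracy of the grid model. -/
theorem samplingLaw_gridError_le {ρ : ℝ} {χ : Fin n → ProbabilityMeasure (DataPoint d)}
    (hχ : ∀ i, χ i ∈ boundedGradientClass d ρ) (hn : 0 < n) {k : ℕ} (hk : 0 < k)
    (hρk : ρ * √(n : ℝ) ≤ 3 * k) {ε : ℝ} (hε : √(n : ℝ) ≤ ε) :
    samplingLaw χ {D | ENNReal.ofReal ε ≤ querySupNorm fun q => distCardinalityFn χ q -
        hitCount {p | ∀ j, recordDigit k j p ≤ queryDigit k q j} D} ≤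
      ENNReal.ofReal (8 * 2 ^ (d + d) * Real.exp ((12 * d + 4) ^ 2 / 128) *
        Real.exp (-(1 / 128) * (ε / √(n : ℝ) - 1) ^ 2)) := by
  have hk' : (0 : ℝ) < k := Nat.cast_pos.2 hk
  have hn' : (0 : ℝ) < n := Nat.cast_pos.2 hn
  set s : ℝ := √(n : ℝ) with hs
  have hs0 : 0 < s := Real.sqrt_pos.2 hn'
  have hss : s * s = n := Real.mul_self_sqrt hn'.le
  have ht : 1 ≤ ε / s := (one_le_div hs0).2 hε
  -- Below this threshold the constant κ₁ makes the bound trivial. Above it, the bias 6ds is at most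
  -- half of ε.
  by_cases hbig : ε ≤ (12 * d + 4) * s
  · refine le_trans (b := 1) ?_ ?_
    · unfold samplingLaw
      exact prob_le_one
    · rw [← ENNReal.ofReal_one]
      refine ENNReal.ofReal_le_ofReal ?_
      rw [mul_assoc, ← Real.exp_add]
      have h1 : ε / s ≤ 12 * d + 4 := (div_le_iff₀ hs0).2 hbig
      have h2 : (0 : ℝ) ≤ (12 * d + 4) ^ 2 / 128 + -(1 / 128) * (ε / s - 1) ^ 2 := by nlinarith
      have h3 : (1 : ℝ) ≤ 2 ^ (d + d) := one_le_pow₀ one_le_two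
      nlinarith [Real.one_le_exp h2]
  · push Not at hbig
    set x : ℝ := ε - 6 * d * s with hx
    have hd : (0 : ℝ) ≤ d := Nat.cast_nonneg d
    have hx1 : ε / 2 ≤ x := by
      rw [hx]; nlinarith
    have hx2 : 2 * s ≤ x := by nlinarith
    have hx0 : 0 < x := by linarith
    have hdev := measure_orthant_deviation_le (k := k) (fun i => (χ i : Measure (DataPoint d)))
      (fun j : Fin (d + d) => recordDigit k j) (measurable_recordDigit k) hn hx0 (by nlinarith)
    refine (measure_mono ?_).trans (hdev.trans (ENNReal.ofReal_le_ofReal ?_))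
    · intro D hD
      by_contra hcon
      simp only [Set.mem_ofPred_eq, not_exists, not_le] at hcon hD
      have : Nonempty (Fin k) := ⟨⟨0, hk⟩⟩
      -- A strict bound at each query would not keep the supremum strictly below ε. All queries
      -- reduce to finitely many orthants, so a maximal deviation exists and is itself less than x.
      obtain ⟨b₀, hb₀⟩ := Finite.exists_max fun b : Fin (d + d) → Fin k =>
        |hitCount {p | ∀ j, recordDigit k j p ≤ b j} D -
          ∑ i, (χ i : Measure (DataPoint d)).real {p | ∀ j, recordDigit k j p ≤ b j}|
      set y := |hitCount {p | ∀ j, recordDigit k j p ≤ b₀ j} D -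
          ∑ i, (χ i : Measure (DataPoint d)).real {p | ∀ j, recordDigit k j p ≤ b₀ j}| with hy
      have hyx : y < x := hcon b₀
      have hsup : querySupNorm (fun q => distCardinalityFn χ q -
          hitCount {p | ∀ j, recordDigit k j p ≤ queryDigit k q j} D) ≤
          ENNReal.ofReal (6 * d * s + y) := by
        refine iSup₂_le fun q _ => ENNReal.ofReal_le_ofReal ?_
        have h1 := abs_distCardinalityFn_sub_grid_le hχ hk q
        have h2 := hb₀ fun j => ⟨queryDigit k q j, queryDigit_lt hk q j⟩
        have h3 : n * (2 * d * (ρ / k)) ≤ 6 * d * s := by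
          rw [← hss]
          have : s * (ρ / k) ≤ 3 := by
            rw [mul_div_assoc', div_le_iff₀ hk', mul_comm s]
            exact hρk
          nlinarith [mul_nonneg hd hs0.le]
        have h4 := abs_sub_le (distCardinalityFn χ q)
          (∑ i, (χ i : Measure (DataPoint d)).real
            {p | ∀ j, recordDigit k j p ≤ queryDigit k q j})
          (hitCount {p | ∀ j, recordDigit k j p ≤ queryDigit k q j} D)
        rw [abs_sub_comm (∑ i, _) (hitCount _ D)] at h4
        exact h4.trans (add_le_add (h1.trans h3) h2)
      have h5 := (ENNReal.ofReal_le_ofReal_iff (by positivity)).1 (hD.trans hsup)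
      linarith
    · have h1 : Real.exp (-x ^ 2 / (32 * n)) ≤ Real.exp (-(1 / 128) * (ε / s - 1) ^ 2) := by
        refine Real.exp_le_exp.2 ?_
        have h2 : -x ^ 2 / (32 * (n : ℝ)) = -(1 / 32) * (x / s) ^ 2 := by
          rw [← hss]; field_simp
        have h3 : ε / s / 2 ≤ x / s := by
          rw [div_right_comm]; gcongr
        rw [h2]
        nlinarith
      have h2 : (1 : ℝ) ≤ Real.exp ((12 * d + 4) ^ 2 / 128) := Real.one_le_exp (by positivity)
      have h3 : (0 : ℝ) < 8 * 2 ^ (d + d) := by positivity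
      calc _ ≤ 8 * 2 ^ (d + d) * Real.exp (-(1 / 128) * (ε / s - 1) ^ 2) := by gcongr
        _ ≤ _ := mul_le_mul_of_nonneg_right (le_mul_of_one_le_right h3.le h2)
            (Real.exp_pos _).le

end Grid

/-! ### Running programs of the real RAM -/

section Run

/-- Started in state `s`, the program `c` halts in state `s'` after at most `T` operations. -/
def RamProg.Runs (c : RamProg) (s : RamState) (T : ℕ) (s' : RamState) : Prop :=
  ∃ t ≤ T, RamExec c s t s'

theorem RamExec.loop_exit {s : RamState} {e₁ e₂ : RamExpr} {c : RamProg}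
    (h : ¬ e₁.eval s ≤ e₂.eval s) :
    RamExec (.loop e₁ e₂ c) s (e₁.size + e₂.size + 1) s := by
  constructor
  exact h

namespace RamProg.Runs

variable {s s₁ s₂ : RamState} {c c₁ c₂ : RamProg} {T T' T₁ T₂ : ℕ}

theorem mono (h : c.Runs s T s₁) (hT : T ≤ T') : c.Runs s T' s₁ := by
  obtain ⟨t, ht, he⟩ := h
  exact ⟨t, ht.trans hT, he⟩

theorem seq (h₁ : c₁.Runs s T₁ s₁) (h₂ : c₂.Runs s₁ T₂ s₂) :
    (RamProg.seq c₁ c₂).Runs s (T₁ + T₂) s₂ := by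
  obtain ⟨t₁, ht₁, he₁⟩ := h₁
  obtain ⟨t₂, ht₂, he₂⟩ := h₂
  exact ⟨t₁ + t₂, add_le_add ht₁ ht₂, .seq he₁ he₂⟩

theorem loop {e₁ e₂ : RamExpr} (N : ℕ) (st : ℕ → RamState)
    (hc : ∀ i < N, e₁.eval (st i) ≤ e₂.eval (st i))
    (hb : ∀ i < N, c.Runs (st i) T (st (i + 1)))
    (hs : ¬ e₁.eval (st N) ≤ e₂.eval (st N)) :
    (RamProg.loop e₁ e₂ c).Runs (st 0) ((N + 1) * (e₁.size + e₂.size + 1) + N * T) (st N) := by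
  induction N generalizing st with
  | zero => exact ⟨_, by simp, .loop_exit hs⟩
  | succ N ih =>
    obtain ⟨t₁, ht₁, he₁⟩ := hb 0 (Nat.succ_pos N)
    obtain ⟨t₂, ht₂, he₂⟩ := ih (fun i => st (i + 1)) (fun i hi => hc _ (by omega))
      (fun i hi => hb _ (by omega)) hs
    refine ⟨_, ?_, .loop_step (hc 0 (Nat.succ_pos N)) he₁ he₂⟩
    calc _ ≤ e₁.size + e₂.size + 1 + T + ((N + 1) * (e₁.size + e₂.size + 1) + N * T) := by
          gcongr
      _ = _ := by ring

end RamProg.Runs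

/-! ### Branch-free expressions for sums, products, grid cells, digits and comparisons. -/

namespace RamExpr

/-- The sum of the first `m` of the expressions `f`. -/
def sumTo (f : ℕ → RamExpr) : ℕ → RamExpr
  | 0 => const 0
  | m + 1 => add (sumTo f m) (f m)

/-- The product of the first `m` of the expressions `f`. -/
def prodTo (f : ℕ → RamExpr) : ℕ → RamExpr
  | 0 => const 1
  | m + 1 => mul (prodTo f m) (f m)

variable (s : RamState)

theorem eval_sumTo (f : ℕ → RamExpr) (m : ℕ) :
    (sumTo f m).eval s = ∑ j ∈ Finset.range m, (f j).eval s := by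
  induction m with
  | zero => simp [sumTo, eval]
  | succ m ih => rw [Finset.sum_range_succ, ← ih]; rfl

theorem eval_prodTo (f : ℕ → RamExpr) (m : ℕ) :
    (prodTo f m).eval s = ∏ j ∈ Finset.range m, (f j).eval s := by
  induction m with
  | zero => simp [prodTo, eval]
  | succ m ih => rw [Finset.prod_range_succ, ← ih]; rfl

theorem size_sumTo_le {f : ℕ → RamExpr} {m a : ℕ} (h : ∀ j < m, (f j).size ≤ a) :
    (sumTo f m).size ≤ 1 + m * (a + 1) := by
  induction m with
  | zero => simp [sumTo, size]
  | succ m ih =>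
    have h1 := ih fun j hj => h j (by omega)
    have h2 := h m (Nat.lt_succ_self m)
    simp only [sumTo, size]
    linarith

theorem size_prodTo_le {f : ℕ → RamExpr} {m a : ℕ} (h : ∀ j < m, (f j).size ≤ a) :
    (prodTo f m).size ≤ 1 + m * (a + 1) := by
  induction m with
  | zero => simp [prodTo, size]
  | succ m ih =>
    have h1 := ih fun j hj => h j (by omega)
    have h2 := h m (Nat.lt_succ_self m)
    simp only [prodTo, size]
    linarith

/-- The `m`-th power of an expression. -/
def pow (e : RamExpr) (m : ℕ) : RamExpr := prodTo (fun _ => e) m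

theorem eval_pow (e : RamExpr) (m : ℕ) : (e.pow m).eval s = e.eval s ^ m := by
  simp [pow, eval_prodTo]

theorem size_pow_le (e : RamExpr) (m : ℕ) : (e.pow m).size ≤ 1 + m * (e.size + 1) :=
  size_prodTo_le fun _ _ => le_rfl

/-- The cell of the grid of mesh `1 / k` that contains `x`. -/
def cell (k x : RamExpr) : RamExpr :=
  add (sub k (const 1)) (mul (floor (div (const 1) (add (const 1) (floor (div (floor (mul k x)) k)))))
    (sub (floor (mul k x)) (sub k (const 1))))

theorem size_cell (k x : RamExpr) : (cell k x).size = 5 * k.size + 2 * x.size + 18 := by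
  simp only [cell, size]
  ring

variable {s} {k : RamExpr} {K : ℕ}

/-- With N = ⌊K x⌋, the factor ⌊1 / (1 + ⌊N / K⌋)⌋ is 1 if N < K and 0 otherwise, so it selects
between N and K - 1. -/
theorem eval_cell (hK : 0 < K) (hk : k.eval s = K) {x : RamExpr} (hx : 0 ≤ x.eval s) :
    (cell k x).eval s = gridCell K (x.eval s) := by
  have hK' : (0 : ℝ) < K := Nat.cast_pos.2 hK
  have h0 : (0 : ℝ) ≤ K * x.eval s := by positivity
  simp only [cell, eval, hk, gridCell]
  set N := ⌊(K : ℝ) * x.eval s⌋₊ with hN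
  have h1 : ((⌊(K : ℝ) * x.eval s⌋ : ℤ) : ℝ) = N := (natCast_floor_eq_intCast_floor h0).symm
  rw [h1]
  rcases lt_or_ge N K with h | h
  · have h2 : ⌊(N : ℝ) / K⌋ = 0 := by
      rw [Int.floor_eq_zero_iff]
      exact ⟨by positivity, (div_lt_one hK').2 (Nat.cast_lt.2 h)⟩
    rw [h2, min_eq_left (by omega)]
    simp
  · have h2 : (1 : ℤ) ≤ ⌊(N : ℝ) / K⌋ := by
      rw [Int.le_floor]
      simpa using (one_le_div hK').2 (Nat.cast_le.2 h)
    have h2' : (1 : ℝ) ≤ (⌊(N : ℝ) / K⌋ : ℝ) := by exact_mod_cast h2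
    have h3 : ⌊(1 : ℝ) / (1 + (⌊(N : ℝ) / K⌋ : ℝ))⌋ = 0 := by
      rw [Int.floor_eq_zero_iff]
      exact ⟨by positivity, (div_lt_one (by positivity)).2 (by linarith)⟩
    rw [h3, min_eq_right (by omega), Nat.cast_sub hK]
    simp

/-- The digit of `v` at position `i` in base `k`. -/
def digit (k v : RamExpr) (i : ℕ) : RamExpr :=
  sub (floor (div v (k.pow i))) (mul k (floor (div v (k.pow (i + 1)))))

theorem size_digit_le (k v : RamExpr) (i : ℕ) :
    (digit k v i).size ≤ 2 * v.size + k.size + (2 * i + 1) * (k.size + 1) + 8 := by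
  have h1 := size_pow_le k i
  have h2 := size_pow_le k (i + 1)
  simp only [digit, size]
  linarith

theorem eval_digit (hk : k.eval s = K) {v : RamExpr} {V : ℕ} (hv : v.eval s = V) (i : ℕ) :
    (digit k v i).eval s = ((V / K ^ i % K : ℕ) : ℝ) := by
  have h : ∀ j, ((⌊(V : ℝ) / (K : ℝ) ^ j⌋ : ℤ) : ℝ) = ((V / K ^ j : ℕ) : ℝ) := by
    intro j
    rw [← natCast_floor_eq_intCast_floor (by positivity), ← Nat.cast_pow, Nat.floor_div_eq_div]
  simp only [digit, eval, eval_pow, hk, hv, h]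
  rw [pow_succ, ← Nat.div_div_eq_div_mul, sub_eq_iff_eq_add]
  exact_mod_cast (Nat.mod_add_div (V / K ^ i) K).symm

/-- The truth value of `a ≤ b`, for `a` and `b` in `[0, k)`. -/
def leBit (k a b : RamExpr) : RamExpr := add (const 1) (floor (div (sub b a) k))

theorem size_leBit (k a b : RamExpr) :
    (leBit k a b).size = a.size + b.size + k.size + 5 := by
  simp only [leBit, size]
  ring

/-- Since |B - A| < K, the floor of (B - A) / K is 0 or -1 according to the sign of B - A. -/
theorem eval_leBit (hk : k.eval s = K) {a b : RamExpr} {A B : ℕ} (ha : a.eval s = A)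
    (hb : b.eval s = B) (hA : A < K) (hB : B < K) :
    (leBit k a b).eval s = if A ≤ B then 1 else 0 := by
  have hK' : (0 : ℝ) < K := Nat.cast_pos.2 (by omega)
  have hA' : (A : ℝ) < K := Nat.cast_lt.2 hA
  have hB' : (B : ℝ) < K := Nat.cast_lt.2 hB
  have hA0 : (0 : ℝ) ≤ A := Nat.cast_nonneg A
  have hB0 : (0 : ℝ) ≤ B := Nat.cast_nonneg B
  simp only [leBit, eval, hk, ha, hb]
  split_ifs with h
  · have h' : (A : ℝ) ≤ B := Nat.cast_le.2 h
    have : ⌊((B : ℝ) - A) / K⌋ = 0 := by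
      rw [Int.floor_eq_zero_iff]
      exact ⟨div_nonneg (by linarith) hK'.le, (div_lt_one hK').2 (by linarith)⟩
    simp [this]
  · have h' : (B : ℝ) < A := Nat.cast_lt.2 (by omega)
    have : ⌊((B : ℝ) - A) / K⌋ = -1 := by
      rw [Int.floor_eq_iff]
      push_cast
      rw [le_div_iff₀ hK', div_lt_iff₀ hK']
      constructor <;> linarith
    simp [this]

end RamExpr

end Run

/-! ### The grid learner -/

section GridLearner

variable {d n : ℕ}

namespace GridLearner

/-- The scalar variables `0, 1, 2, 3, …` of the training program, held in array `2`. -/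
def scalar (m : ℕ) : RamExpr := .read 2 (.const m)

/-- The number of records. -/
def recordCount : RamExpr := .read 0 (.const 0)

/-- The coordinate `j` of the record whose number is in scalar `3`. -/
def recordCoord (d j : ℕ) : RamExpr :=
  .read 1 (.add (.mul (scalar 3) (.const d)) (.const j))

/-- Whether the current record counts for the table entry whose number is in scalar `1`, in the
coordinate `j`; the number of cells is in scalar `0`. -/
def coordBit (d j : ℕ) : RamExpr :=
  .mul (.leBit (scalar 0) (.cell (scalar 0) (recordCoord d j)) (.digit (scalar 0) (scalar 1) j))
    (.leBit (scalar 0)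
      (.sub (.sub (scalar 0) (.const 1)) (.cell (scalar 0) (recordCoord d j)))
      (.digit (scalar 0) (scalar 1) (d + j)))

/-- Twice the square of the next number of cells. -/
noncomputable def growLhs : RamExpr :=
  .mul (.const 2) (.mul (.add (scalar 0) (.const 1)) (.add (scalar 0) (.const 1)))

/-- The bound on `growLhs` up to which the number of cells is increased. -/
noncomputable def growRhs (ρ : ℝ) : RamExpr := .mul (.const (ρ ^ 2)) recordCount

/-- Assign to a scalar variable. -/
def assign (m : ℕ) (e : RamExpr) : RamProg := .write 2 (.const m) e

/-- Count the records for one table entry. -/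
def countStep (d : ℕ) : RamProg :=
  .seq (assign 2 (.add (scalar 2) (.prodTo (coordBit d) d)))
    (assign 3 (.add (scalar 3) (.const 1)))

/-- Compute one table entry. -/
def entryStep (d : ℕ) : RamProg :=
  .seq (assign 2 (.const 0)) (.seq (assign 3 (.const 0))
    (.seq (.loop (.add (scalar 3) (.const 1)) recordCount (countStep d))
      (.seq (.emit (scalar 2)) (assign 1 (.add (scalar 1) (.const 1))))))

/-- The training program: it chooses the number of cells and tabulates the counts of all grid
boxes. -/
noncomputable def train (d : ℕ) (ρ : ℝ) : RamProg :=
  .seq (assign 0 (.const 1))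
    (.seq (.loop growLhs (growRhs ρ) (assign 0 (.add (scalar 0) (.const 1))))
      (.seq (.emit (scalar 0))
        (.loop (.add (scalar 1) (.const 1)) (.pow (scalar 0) (d + d)) (entryStep d))))

/-- The values of the scalar variables during training. -/
noncomputable def scalars (k v c i : ℕ) : ℕ → ℝ
  | 0 => k
  | 1 => v
  | 2 => c
  | 3 => i
  | _ => 0

/-- The states of the training program. -/
noncomputable def state (D : Dataset d n) (x : ℕ → ℝ) (out : List ℕ) : RamState :=
  ⟨Function.update (trainStart D).arr 2 x, out⟩

theorem state_scalars_zero (D : Dataset d n) : state D (scalars 0 0 0 0) [] = trainStart D := by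
  have : (trainStart D).arr 2 = scalars 0 0 0 0 := by
    funext m
    rcases m with _ | _ | _ | _ | m <;> simp [trainStart, scalars]
  simp [state, ← this, Function.update_eq_self]
  rfl

section
variable (D : Dataset d n) (x : ℕ → ℝ) (out : List ℕ)

theorem eval_scalar (m : ℕ) : (scalar m).eval (state D x out) = x m := by
  simp [scalar, RamExpr.eval, state]

theorem eval_recordCount : recordCount.eval (state D x out) = n := by
  simp [recordCount, RamExpr.eval, state, trainStart]

theorem eval_recordCoord {i : Fin n} (hx : x 3 = (i : ℕ)) (j : Fin d) :
    (recordCoord d j).eval (state D x out) = D i j := by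
  have h1 : (recordCoord d j).eval (state D x out) =
      (trainStart D).arr 1 (i * d + j) := by
    simp only [recordCoord, RamExpr.eval, eval_scalar, hx]
    rw [show ((i : ℕ) : ℝ) * (d : ℝ) + ((j : ℕ) : ℝ) = ((i * d + j : ℕ) : ℝ) by push_cast; rfl,
      Nat.floor_natCast]
    simp [state]
  have h2 : (i : ℕ) * d + j < n * d := by
    have := i.2
    have := j.2
    calc (i : ℕ) * d + j < i * d + d := by omega
      _ = (i + 1) * d := by ring
      _ ≤ n * d := Nat.mul_le_mul_right d i.2
  have h3 : (⟨i * d + j, h2⟩ : Fin (n * d)) = finProdFinEquiv (i, j) := by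
    ext
    simp [finProdFinEquiv]
    ring
  rw [h1]
  simp only [trainStart, h2, and_true, dif_pos, h3, Equiv.symm_apply_apply, one_ne_zero,
    false_and, if_false]

theorem runs_assign (m : ℕ) (e : RamExpr) :
    (assign m e).Runs (state D x out) (e.size + 2)
      (state D (Function.update x m (e.eval (state D x out))) out) := by
  have h := RamExec.write (state D x out) 2 (.const m) e
  refine ⟨(RamExpr.const m).size + e.size + 1, ?_, ?_⟩
  · simp only [RamExpr.size]
    omega
  · have heq : state D (Function.update x m (e.eval (state D x out))) out =
        ⟨Function.update (state D x out).arr 2 (Function.update ((state D x out).arr 2)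
          ⌊(RamExpr.const m).eval (state D x out)⌋₊ (e.eval (state D x out))),
          (state D x out).out⟩ := by
      simp [state, RamExpr.eval]
    rw [heq]
    exact h

theorem runs_emit (e : RamExpr) :
    (RamProg.emit e).Runs (state D x out) (e.size + 1)
      (state D x (out ++ [⌊e.eval (state D x out)⌋₊])) :=
  ⟨_, le_rfl, RamExec.emit (state D x out) e⟩

end

/-- The truth value of "record `p` counts for the table entry `v`". -/
noncomputable def recordBit (k v : ℕ) (p : DataPoint d) : ℕ :=
  open Classical in if ∀ j : Fin (d + d), recordDigit k j p ≤ v / k ^ (j : ℕ) % k then 1 else 0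

/-- The sum of `recordBit` over the first `i` records. -/
noncomputable def partialCount (k v : ℕ) (D : Dataset d n) (i : ℕ) : ℕ :=
  ∑ i' ∈ Finset.range i, if h : i' < n then recordBit k v (D ⟨i', h⟩) else 0

theorem partialCount_eq (k v : ℕ) (D : Dataset d n) :
    partialCount k v D n = ∑ i, recordBit k v (D i) := by
  unfold partialCount
  rw [← Fin.sum_univ_eq_sum_range (fun i' => if h : i' < n then recordBit k v (D ⟨i', h⟩) else 0)]
  simp

theorem eval_prod_coordBit {k v c i : ℕ} (hk : 0 < k) (D : Dataset d n) (out : List ℕ)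
    (hi : i < n) :
    (RamExpr.prodTo (coordBit d) d).eval (state D (scalars k v c i) out) =
      recordBit k v (D ⟨i, hi⟩) := by
  classical
  set s := state D (scalars k v c i) out with hs
  have hk0 : (scalar 0).eval s = k := eval_scalar D _ out 0
  have hv1 : (scalar 1).eval s = v := eval_scalar D _ out 1
  have hbit : ∀ j : Fin d, (coordBit d j).eval s =
      (if recordDigit k (Fin.castAdd d j) (D ⟨i, hi⟩) ≤ v / k ^ (Fin.castAdd d j : ℕ) % k then 1
        else 0) *
      (if recordDigit k (Fin.natAdd d j) (D ⟨i, hi⟩) ≤ v / k ^ (Fin.natAdd d j : ℕ) % k then 1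
        else 0) := by
    intro j
    have hc : (RamExpr.cell (scalar 0) (recordCoord d j)).eval s =
        gridCell k (D ⟨i, hi⟩ j) := by
      have h1 : (recordCoord d j).eval s = D ⟨i, hi⟩ j := eval_recordCoord D _ out rfl j
      rw [RamExpr.eval_cell hk hk0 (by rw [h1]; exact (D ⟨i, hi⟩ j).2.1), h1]
    have hlt := gridCell_lt hk (D ⟨i, hi⟩ j)
    have hc' : (RamExpr.sub (.sub (scalar 0) (.const 1))
        (.cell (scalar 0) (recordCoord d j))).eval s =
        ((k - 1 - gridCell k (D ⟨i, hi⟩ j) : ℕ) : ℝ) := by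
      simp only [RamExpr.eval, hc, hk0]
      rw [Nat.cast_sub (by omega), Nat.cast_sub (by omega), Nat.cast_one]
    simp only [coordBit, RamExpr.eval]
    rw [RamExpr.eval_leBit hk0 hc (RamExpr.eval_digit hk0 hv1 _) hlt (Nat.mod_lt _ hk),
      RamExpr.eval_leBit hk0 hc' (RamExpr.eval_digit hk0 hv1 _) (by omega) (Nat.mod_lt _ hk)]
    simp only [recordDigit, Fin.addCases_left, Fin.addCases_right, Fin.val_castAdd,
      Fin.val_natAdd]
  rw [RamExpr.eval_prodTo, ← Fin.prod_univ_eq_prod_range (fun j => (coordBit d j).eval s)]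
  simp only [hbit, recordBit, Fin.forall_fin_add]
  rw [Finset.prod_mul_distrib, Finset.prod_ite_zero, Finset.prod_ite_zero]
  simp only [Finset.prod_const_one, Finset.mem_univ, true_implies]
  have hand : ∀ (A B : Prop) [Decidable A] [Decidable B] [Decidable (A ∧ B)],
      (if A then (1 : ℝ) else 0) * (if B then 1 else 0) = ((if A ∧ B then 1 else 0 : ℕ) : ℝ) := by
    intro A B _ _ _
    by_cases hA : A <;> by_cases hB : B <;> simp [hA, hB]
  exact hand _ _

theorem update_scalars_zero (k v c i m : ℕ) :
    Function.update (scalars k v c i) 0 (m : ℝ) = scalars m v c i := by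
  funext j; rcases j with _ | _ | _ | _ | j <;> simp [scalars, Function.update]

theorem update_scalars_one (k v c i m : ℕ) :
    Function.update (scalars k v c i) 1 (m : ℝ) = scalars k m c i := by
  funext j; rcases j with _ | _ | _ | _ | j <;> simp [scalars, Function.update]

theorem update_scalars_two (k v c i m : ℕ) :
    Function.update (scalars k v c i) 2 (m : ℝ) = scalars k v m i := by
  funext j; rcases j with _ | _ | _ | _ | j <;> simp [scalars, Function.update]

theorem update_scalars_three (k v c i m : ℕ) :
    Function.update (scalars k v c i) 3 (m : ℝ) = scalars k v c m := by
  funext j; rcases j with _ | _ | _ | _ | j <;> simp [scalars, Function.update]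

theorem runs_assign_of_eval (D : Dataset d n) (x x' : ℕ → ℝ) (out : List ℕ) {m : ℕ} {e : RamExpr}
    {V : ℕ} (he : e.eval (state D x out) = V) (hx : Function.update x m (V : ℝ) = x') :
    (assign m e).Runs (state D x out) (e.size + 2) (state D x' out) := by
  have := runs_assign D x out m e
  rwa [he, hx] at this

theorem runs_countStep {k v c i : ℕ} (hk : 0 < k) (D : Dataset d n) (out : List ℕ) (hi : i < n) :
    (countStep d).Runs (state D (scalars k v c i) out) (countStep d).size
      (state D (scalars k v (c + recordBit k v (D ⟨i, hi⟩)) (i + 1)) out) := by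
  refine (RamProg.Runs.seq (runs_assign_of_eval D _ _ out ?_ (update_scalars_two k v c i _))
    (runs_assign_of_eval D _ _ out ?_ (update_scalars_three k v _ i _))).mono ?_
  · simp only [RamExpr.eval, eval_scalar, eval_prod_coordBit hk D out hi]
    simp [scalars]
  · simp only [RamExpr.eval, eval_scalar]
    simp [scalars]
  · simp only [countStep, assign, RamProg.size, RamExpr.size]
    omega

/-- The initial c and i are arbitrary because scalars 2 and 3 still hold what the previous entry
left there. -/
theorem runs_entryStep {k v c i : ℕ} (hk : 0 < k) (D : Dataset d n) (out : List ℕ) :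
    (entryStep d).Runs (state D (scalars k v c i) out) (3 * (n + 1) * (entryStep d).size)
      (state D (scalars k (v + 1) (∑ i, recordBit k v (D i)) n)
        (out ++ [∑ i, recordBit k v (D i)])) := by
  have h1 : (assign 2 (.const 0)).Runs (state D (scalars k v c i) out) _
      (state D (scalars k v 0 i) out) :=
    runs_assign_of_eval D _ _ out (V := 0) (by simp [RamExpr.eval]) (update_scalars_two k v c i 0)
  have h2 : (assign 3 (.const 0)).Runs (state D (scalars k v 0 i) out) _
      (state D (scalars k v 0 0) out) :=
    runs_assign_of_eval D _ _ out (V := 0) (by simp [RamExpr.eval]) (update_scalars_three k v 0 i 0)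
  have h3 : (RamProg.loop (.add (scalar 3) (.const 1)) recordCount (countStep d)).Runs
      (state D (scalars k v (partialCount k v D 0) 0) out)
      ((n + 1) * ((RamExpr.add (scalar 3) (.const 1)).size + recordCount.size + 1) +
        n * (countStep d).size)
      (state D (scalars k v (partialCount k v D n) n) out) := by
    refine RamProg.Runs.loop n (fun i => state D (scalars k v (partialCount k v D i) i) out)
      (fun i hi => ?_) (fun i hi => ?_) ?_ (T := (countStep d).size)
    · simp only [RamExpr.eval, eval_scalar, eval_recordCount, scalars]
      exact_mod_cast hi
    · have := runs_countStep (v := v) (c := partialCount k v D i) hk D out hi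
      convert this using 3
      simp [partialCount, Finset.sum_range_succ, hi]
    · simp only [RamExpr.eval, eval_scalar, eval_recordCount, scalars]
      push Not
      linarith
  rw [show partialCount k v D 0 = 0 by simp [partialCount], partialCount_eq] at h3
  have h4 := runs_emit D (scalars k v (∑ i, recordBit k v (D i)) n) out (scalar 2)
  rw [eval_scalar, show scalars k v (∑ i, recordBit k v (D i)) n 2 =
    ((∑ i, recordBit k v (D i) : ℕ) : ℝ) from rfl, Nat.floor_natCast] at h4
  have h5 : (assign 1 (.add (scalar 1) (.const 1))).Runs
      (state D (scalars k v (∑ i, recordBit k v (D i)) n) (out ++ [∑ i, recordBit k v (D i)])) _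
      (state D (scalars k (v + 1) (∑ i, recordBit k v (D i)) n)
        (out ++ [∑ i, recordBit k v (D i)])) :=
    runs_assign_of_eval D _ _ _ (by simp [RamExpr.eval, eval_scalar, scalars])
      (update_scalars_one k v _ n (v + 1))
  refine (h1.seq (h2.seq (h3.seq (h4.seq h5)))).mono ?_
  simp only [entryStep, assign, scalar, recordCount, RamProg.size, RamExpr.size]
  nlinarith [Nat.zero_le (n * (countStep d).size)]

/-- After i rounds the number of cells is i + 1 and the guard tests the next one, i + 2; the loop
ends after k - 1 rounds. -/
theorem runs_grow {k : ℕ} {ρ : ℝ} (D : Dataset d n) (hk : 0 < k)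
    (hlow : ∀ i < k - 1, 2 * ((i + 2 : ℕ) : ℝ) ^ 2 ≤ ρ ^ 2 * n)
    (hhigh : ρ ^ 2 * n < 2 * ((k + 1 : ℕ) : ℝ) ^ 2) :
    (RamProg.loop growLhs (growRhs ρ) (assign 0 (.add (scalar 0) (.const 1)))).Runs
      (state D (scalars 1 0 0 0) []) (30 * k) (state D (scalars k 0 0 0) []) := by
  have h := RamProg.Runs.loop (e₁ := growLhs) (e₂ := growRhs ρ)
    (c := assign 0 (.add (scalar 0) (.const 1))) (T := 6) (k - 1)
    (fun i => state D (scalars (i + 1) 0 0 0) []) (fun i hi => ?_) (fun i hi => ?_) ?_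
  · simp only [Nat.sub_add_cancel hk, zero_add] at h
    refine h.mono ?_
    simp only [growLhs, growRhs, scalar, recordCount, RamExpr.size]
    omega
  · simp only [growLhs, growRhs, RamExpr.eval, eval_scalar, eval_recordCount, scalars]
    have := hlow i hi
    push_cast at this ⊢
    nlinarith
  · refine (runs_assign_of_eval D _ _ _ (V := i + 1 + 1) ?_
      (update_scalars_zero (i + 1) 0 0 0 _)).mono ?_
    · simp [RamExpr.eval, eval_scalar, scalars]
    · simp [scalar, RamExpr.size]
  · simp only [growLhs, growRhs, RamExpr.eval, eval_scalar, eval_recordCount, scalars,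
      Nat.sub_add_cancel hk]
    push_cast at hhigh ⊢
    nlinarith

/-- The table that training produces. -/
noncomputable def table (k : ℕ) (D : Dataset d n) : List ℕ :=
  k :: (List.range (k ^ (d + d))).map fun v => ∑ i, recordBit k v (D i)

theorem runs_train {k : ℕ} {ρ : ℝ} (D : Dataset d n) (hd : 0 < d) (hn : 0 < n) (hk : 0 < k)
    (hlow : ∀ i < k - 1, 2 * ((i + 2 : ℕ) : ℝ) ^ 2 ≤ ρ ^ 2 * n)
    (hhigh : ρ ^ 2 * n < 2 * ((k + 1 : ℕ) : ℝ) ^ 2) :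
    ∃ s : RamState, s.out = table k D ∧
      (train d ρ).Runs (trainStart D) (n * (40 * (train d ρ).size * k ^ (d + d))) s := by
  set N := k ^ (d + d) with hN
  have h1 : (assign 0 (.const 1)).Runs (trainStart D) ((RamExpr.const 1).size + 2)
      (state D (scalars 1 0 0 0) []) := by
    rw [← state_scalars_zero]
    exact runs_assign_of_eval D _ _ [] (V := 1) (by simp [RamExpr.eval])
      (update_scalars_zero 0 0 0 0 1)
  have h2 := runs_grow D hk hlow hhigh
  have h3 := runs_emit D (scalars k 0 0 0) [] (scalar 0)
  rw [eval_scalar, show scalars k 0 0 0 0 = (k : ℝ) from rfl, Nat.floor_natCast,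
    List.nil_append] at h3
  -- What scalars 2 and 3 contain before entry v: their initial zeros if v = 0, otherwise the count
  -- and the loop index left by entry v - 1.
  let cnt : ℕ → ℕ := fun v => if v = 0 then 0 else ∑ i, recordBit k (v - 1) (D i)
  let idx : ℕ → ℕ := fun v => if v = 0 then 0 else n
  let st : ℕ → RamState := fun v => state D (scalars k v (cnt v) (idx v))
    (k :: (List.range v).map fun v => ∑ i, recordBit k v (D i))
  have h4 : (RamProg.loop (.add (scalar 1) (.const 1)) (.pow (scalar 0) (d + d))
      (entryStep d)).Runs (st 0)
      ((N + 1) * ((RamExpr.add (scalar 1) (.const 1)).size +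
        (RamExpr.pow (scalar 0) (d + d)).size + 1) + N * (3 * (n + 1) * (entryStep d).size))
      (st N) := by
    refine RamProg.Runs.loop N st (fun v hv => ?_) (fun v hv => ?_) ?_
      (T := 3 * (n + 1) * (entryStep d).size)
    · simp only [st, RamExpr.eval, RamExpr.eval_pow, eval_scalar, scalars]
      exact_mod_cast hv
    · have := runs_entryStep (v := v) (c := cnt v) (i := idx v) hk D
        (k :: (List.range v).map fun v => ∑ i, recordBit k v (D i))
      have hst : st (v + 1) = state D (scalars k (v + 1) (∑ i, recordBit k v (D i)) n)
          ((k :: (List.range v).map fun v => ∑ i, recordBit k v (D i)) ++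
            [∑ i, recordBit k v (D i)]) := by
        simp [st, cnt, idx, List.range_succ]
      rw [hst]
      exact this
    · simp only [st, RamExpr.eval, RamExpr.eval_pow, eval_scalar, scalars]
      rw [hN]
      push_cast
      linarith
  refine ⟨st N, rfl, (h1.seq (h2.seq (h3.seq h4))).mono ?_⟩
  have hNk : k ≤ N := Nat.le_self_pow (by omega) k
  set P := (RamExpr.pow (scalar 0) (d + d)).size with hP
  set E := (entryStep d).size with hE
  have hsize : (train d ρ).size = 36 + P + E := by
    simp only [train, assign, growLhs, growRhs, scalar, recordCount, RamProg.size, RamExpr.size,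
      hP, hE]
    omega
  have hsc : (scalar 1).size = 2 ∧ (scalar 0).size = 2 := ⟨rfl, rfl⟩
  simp only [RamExpr.size, hsc.1, hsc.2, hsize]
  have hN1 : 1 ≤ N := hk.trans_le hNk
  have a1 : N ≤ n * N := Nat.le_mul_of_pos_left N hn
  have a2 : P ≤ N * P := Nat.le_mul_of_pos_left P hN1
  have a3 : N * P ≤ n * (N * P) := Nat.le_mul_of_pos_left _ hn
  have a4 : N * E ≤ n * (N * E) := Nat.le_mul_of_pos_left _ hn
  calc _ ≤ 1 + 2 + (30 * N + (2 + 1 + ((N + 1) * (2 + 1 + 1 + P + 1) +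
        N * (3 * (n + 1) * E)))) := by gcongr
    _ = 11 + 35 * N + N * P + P + 3 * (n * (N * E)) + 3 * (N * E) := by ring
    _ ≤ 46 * (n * N) + 2 * (n * (N * P)) + 6 * (n * (N * E)) := by linarith
    _ ≤ 1440 * (n * N) + 40 * (n * (N * P)) + 40 * (n * (N * E)) := by
      gcongr <;> norm_num
    _ = _ := by ring

end GridLearner

end GridLearner

/-! ### The inference program, and estimates of length, space and grid size. -/

section GridLearner

variable {d n : ℕ}

namespace GridLearner

/-- The number of cells, as stored in the table. -/
def storedSize : RamExpr := .read 1 (.const 0)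

/-- The `j`-th entry of the query. -/
def queryEntry (j : ℕ) : RamExpr := .read 0 (.const j)

/-- The position of the answer in the table. -/
noncomputable def tableIndex (d : ℕ) : RamExpr :=
  .add (.sumTo (fun j => .mul (.cell storedSize (.add (queryEntry j) (queryEntry (d + j))))
      (.pow storedSize j)) d)
    (.sumTo (fun j => .mul (.sub (.sub storedSize (.const 1)) (.cell storedSize (queryEntry j)))
      (.pow storedSize (d + j))) d)

/-- The inference program: it rounds the query to the grid and looks up the count. -/
noncomputable def infer (d : ℕ) : RamProg :=
  .write 2 (.const 0) (.read 1 (.add (.const 1) (tableIndex d)))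

theorem eval_queryEntry (l : List ℕ) (q : RangeQuery d) {m : ℕ} (h : m < d + d) :
    (queryEntry m).eval (evalStart l q) = q (finSumFinEquiv.symm ⟨m, h⟩) := by
  simp [queryEntry, RamExpr.eval, evalStart, h]

theorem evalStart_arr_one (l : List ℕ) (q : RangeQuery d) (m : ℕ) :
    (evalStart l q).arr 1 m = (l.getD m 0 : ℕ) := by
  simp [evalStart]

/-- The position of a query in the table. -/
noncomputable def queryIndex (k : ℕ) (q : RangeQuery d) : ℕ :=
  ∑ j : Fin (d + d), queryDigit k q j * k ^ (j : ℕ)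

theorem eval_tableIndex {k : ℕ} (hk : 0 < k) {l : List ℕ} (hl : l.getD 0 0 = k)
    {q : RangeQuery d} (hq : q ∈ queryDomain d) :
    (tableIndex d).eval (evalStart l q) = queryIndex k q := by
  set s := evalStart l q
  have hks : storedSize.eval s = k := by
    simp only [storedSize, RamExpr.eval, s, Nat.floor_zero, evalStart_arr_one, hl]
  have hinl : ∀ j : Fin d, (queryEntry j).eval s = q (Sum.inl j) := fun j =>
    (eval_queryEntry l q (by omega)).trans
      (congrArg q (finSumFinEquiv_symm_apply_castAdd (n := d) j))
  have hinr : ∀ j : Fin d, (queryEntry (d + j)).eval s = q (Sum.inr j) := fun j =>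
    (eval_queryEntry l q (by omega)).trans
      (congrArg q (finSumFinEquiv_symm_apply_natAdd (m := d) j))
  have h1 : ∀ j : Fin d, (RamExpr.cell storedSize (.add (queryEntry j) (queryEntry (d + j)))).eval s
      = gridCell k (q (Sum.inl j) + q (Sum.inr j)) := by
    intro j
    have he : (RamExpr.add (queryEntry j) (queryEntry (d + j))).eval s =
        q (Sum.inl j) + q (Sum.inr j) := by
      simp only [RamExpr.eval, hinl, hinr]
    rw [RamExpr.eval_cell hk hks (by rw [he]; exact add_nonneg (hq _).1 (hq _).1), he]
  have h2 : ∀ j : Fin d, (RamExpr.cell storedSize (queryEntry j)).eval s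
      = gridCell k (q (Sum.inl j)) := by
    intro j
    rw [RamExpr.eval_cell hk hks (by rw [hinl]; exact (hq _).1), hinl]
  simp only [tableIndex, RamExpr.eval, RamExpr.eval_sumTo, queryIndex]
  rw [← Fin.sum_univ_eq_sum_range, ← Fin.sum_univ_eq_sum_range, Fin.sum_univ_add]
  push_cast
  simp only [h1, h2, RamExpr.eval_pow, hks, queryDigit, Fin.addCases_left, Fin.addCases_right,
    Fin.val_castAdd, Fin.val_natAdd]
  congr 1
  refine Finset.sum_congr rfl fun j _ => ?_
  have := gridCell_lt hk (q (Sum.inl j))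
  rw [Nat.cast_sub (by omega), Nat.cast_sub (by omega), Nat.cast_one]

/-- Uniqueness of base-k expansions: training decodes the index back into exactly the digits from
which inference encoded it. -/
theorem queryIndex_spec {k : ℕ} (hk : 0 < k) (q : RangeQuery d) :
    queryIndex k q < k ^ (d + d) ∧
      ∀ j : Fin (d + d), queryIndex k q / k ^ (j : ℕ) % k = queryDigit k q j := by
  let f : Fin (d + d) → Fin k := fun j => ⟨queryDigit k q j, queryDigit_lt hk q j⟩
  have h1 : (finFunctionFinEquiv f : ℕ) = queryIndex k q := finFunctionFinEquiv_apply f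
  refine ⟨h1 ▸ (finFunctionFinEquiv f).2, fun j => ?_⟩
  have h2 := congrArg Fin.val (congrFun (finFunctionFinEquiv.symm_apply_apply f) j)
  rw [← h1]
  exact h2

theorem sum_recordBit_queryIndex {k : ℕ} (hk : 0 < k) (q : RangeQuery d) (D : Dataset d n) :
    ((∑ i, recordBit k (queryIndex k q) (D i) : ℕ) : ℝ) =
      hitCount {p | ∀ j, recordDigit k j p ≤ queryDigit k q j} D := by
  classical
  simp only [recordBit, (queryIndex_spec hk q).2, hitCount]
  push_cast
  refine Finset.sum_congr rfl fun i _ => ?_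
  simp [Set.indicator_apply]

theorem answers {k : ℕ} (hk : 0 < k) (D : Dataset d n) {q : RangeQuery d}
    (hq : q ∈ queryDomain d) :
    QueryModel.Answers ⟨infer d, table k D⟩ q
      (hitCount {p | ∀ j, recordDigit k j p ≤ queryDigit k q j} D) (infer d).size := by
  refine ⟨_, _, RamExec.write _ _ _ _, ?_, le_rfl⟩
  have hl : (table k D).getD 0 0 = k := rfl
  simp only [RamExpr.eval, Nat.floor_zero, Function.update_self, eval_tableIndex hk hl hq]
  -- The counts are shifted by one because the table begins with k.
  rw [show (1 : ℝ) + (queryIndex k q : ℝ) = ((queryIndex k q + 1 : ℕ) : ℝ) by push_cast; ring,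
    Nat.floor_natCast]
  rw [evalStart_arr_one, ← sum_recordBit_queryIndex hk]
  simp only [table, List.getD_cons_succ]
  rw [List.getD_eq_getElem _ _ (by simpa using (queryIndex_spec hk q).1)]
  simp

theorem size_infer_le (d : ℕ) : (infer d).size ≤ 200 * (d + 1) ^ 2 := by
  have hs : storedSize.size = 2 := rfl
  have hq : ∀ j, (queryEntry j).size = 2 := fun _ => rfl
  have h1 := RamExpr.size_sumTo_le (m := d) (a := 6 * d + 60) (f := fun j =>
    .mul (.cell storedSize (.add (queryEntry j) (queryEntry (d + j)))) (.pow storedSize j))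
    fun j hj => by
      have := RamExpr.size_pow_le storedSize j
      simp only [RamExpr.size, RamExpr.size_cell, hs, hq] at this ⊢
      omega
  have h2 := RamExpr.size_sumTo_le (m := d) (a := 6 * d + 60) (f := fun j =>
    .mul (.sub (.sub storedSize (.const 1)) (.cell storedSize (queryEntry j)))
      (.pow storedSize (d + j)))
    fun j hj => by
      have := RamExpr.size_pow_le storedSize (d + j)
      simp only [RamExpr.size, RamExpr.size_cell, hs, hq] at this ⊢
      omega
  simp only [infer, RamProg.size, tableIndex, RamExpr.size]
  nlinarith

theorem size_train_le (d : ℕ) (ρ : ℝ) : (train d ρ).size ≤ 300 * (d + 1) ^ 2 := by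
  have hs : ∀ m, (scalar m).size = 2 := fun _ => rfl
  have hr : recordCount.size = 2 := rfl
  have hc : ∀ j, (recordCoord d j).size = 7 := fun _ => rfl
  have h1 := RamExpr.size_prodTo_le (m := d) (a := 24 * d + 180) (f := coordBit d)
    fun j hj => by
      have h1 := RamExpr.size_digit_le (scalar 0) (scalar 1) j
      have h2 := RamExpr.size_digit_le (scalar 0) (scalar 1) (d + j)
      simp only [hs] at h1 h2
      simp only [coordBit, RamExpr.size, RamExpr.size_leBit, RamExpr.size_cell, hs, hc]
      omega
  have h2 := RamExpr.size_pow_le (scalar 0) (d + d)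
  simp only [hs] at h2
  simp only [train, entryStep, countStep, assign, growLhs, growRhs, RamProg.size, RamExpr.size,
    hs, hr]
  nlinarith

theorem space_le {k : ℕ} (D : Dataset d n) :
    QueryModel.space ⟨infer d, table k D⟩ ≤
      (infer d).size + (Nat.size k + 1) + k ^ (d + d) * (Nat.size n + 1) := by
  have h : ∀ v, ∑ i, recordBit k v (D i) ≤ n := by
    intro v
    calc _ ≤ ∑ _i : Fin n, 1 := Finset.sum_le_sum fun i _ => by
          unfold recordBit; split_ifs <;> simp
      _ = n := by simp
  simp only [QueryModel.space, table, List.map_cons, List.sum_cons, List.map_map]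
  rw [← add_assoc]
  refine Nat.add_le_add_left ?_ _
  refine (List.sum_le_card_nsmul _ (Nat.size n + 1) fun x hx => ?_).trans_eq (by simp)
  obtain ⟨v, -, rfl⟩ := List.mem_map.1 hx
  exact Nat.add_le_add_right (Nat.size_le_size (h v)) 1

/-- The guard of the growth loop first fails at k + 1; minimality of k gives the upper bounds on all
earlier sizes. -/
theorem exists_gridSize (y : ℝ) : ∃ k : ℕ, 0 < k ∧
    (∀ i < k - 1, 2 * ((i + 2 : ℕ) : ℝ) ^ 2 ≤ y) ∧ y < 2 * ((k + 1 : ℕ) : ℝ) ^ 2 := by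
  classical
  have hex : ∃ m : ℕ, y < 2 * ((m + 2 : ℕ) : ℝ) ^ 2 := by
    obtain ⟨m, hm⟩ := exists_nat_gt y
    refine ⟨m, ?_⟩
    have : (0 : ℝ) ≤ m := Nat.cast_nonneg m
    push_cast
    nlinarith
  exact ⟨Nat.find hex + 1, Nat.succ_pos _, fun i hi => not_lt.1 (Nat.find_min hex hi),
    Nat.find_spec hex⟩

/-- Lets the factor 2^d saved by the choice of k absorb the program length. -/
theorem succ_sq_le_two_pow (d : ℕ) : (d + 1) ^ 2 ≤ 4 * 2 ^ d := by
  induction d with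
  | zero => norm_num
  | succ d ih =>
    rcases Nat.lt_or_ge d 2 with h | h
    · interval_cases d <;> norm_num
    · rw [pow_succ 2 d]
      nlinarith

theorem size_add_one_le_log {n : ℕ} (hn : 2 ≤ n) : (Nat.size n : ℝ) + 1 ≤ 6 * Real.log n := by
  have hn' : (2 : ℝ) ≤ n := by exact_mod_cast hn
  have hlog2 : (1 / 2 : ℝ) ≤ Real.log 2 := by linarith [Real.log_two_gt_d9]
  have hlog : Real.log 2 ≤ Real.log n := Real.log_le_log two_pos hn'
  have hpos : 0 < Nat.size n := Nat.size_pos.2 (by omega)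
  have h1 : 2 ^ (Nat.size n - 1) ≤ n := Nat.lt_size.1 (by omega)
  have h2 : ((Nat.size n - 1 : ℕ) : ℝ) * Real.log 2 ≤ Real.log n := by
    rw [← Real.log_pow]
    exact Real.log_le_log (by positivity) (by exact_mod_cast h1)
  rw [Nat.cast_sub hpos, Nat.cast_one] at h2
  have h3 : (0 : ℝ) ≤ (Nat.size n : ℝ) - 1 := by
    have : (1 : ℝ) ≤ Nat.size n := by exact_mod_cast hpos
    linarith
  nlinarith

/-- For k ≥ 2 the last successful guard gives 2k² ≤ ρ²n; for k = 1 this follows from ρ ≥ 1 and n ≥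
2. Then take d-th powers. -/
theorem two_pow_mul_le {ρ : ℝ} (hρ : 1 ≤ ρ) {n : ℕ} (hn : 2 ≤ n) {k : ℕ} (hk : 0 < k)
    (hlow : ∀ i < k - 1, 2 * ((i + 2 : ℕ) : ℝ) ^ 2 ≤ ρ ^ 2 * n) (d : ℕ) :
    (2 : ℝ) ^ d * (k : ℝ) ^ (d + d) ≤ (ρ * √(n : ℝ)) ^ (2 * d) := by
  have hn' : (2 : ℝ) ≤ n := by exact_mod_cast hn
  have h1 : 2 * (k : ℝ) ^ 2 ≤ ρ ^ 2 * n := by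
    rcases Nat.lt_or_ge k 2 with h | h
    · have : k = 1 := by omega
      subst this
      norm_num
      nlinarith
    · have := hlow (k - 2) (by omega)
      rwa [Nat.sub_add_cancel h] at this
  calc (2 : ℝ) ^ d * (k : ℝ) ^ (d + d) = (2 * (k : ℝ) ^ 2) ^ d := by
        rw [mul_pow, ← pow_mul, two_mul]
    _ ≤ (ρ ^ 2 * n) ^ d := by gcongr
    _ = _ := by rw [pow_mul, mul_pow ρ, Real.sq_sqrt (by positivity)]

end GridLearner

open GridLearner

/-- Distributions with bounded gradient are learned by the grid learner. -/
theorem boundedGradientClass_uniformlyDistributionLearnable (hd : 0 < d) {ρ : ℝ}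
    (hne : (boundedGradientClass d ρ).Nonempty) :
    ∃ T S B : ℕ → ℝ,
      UniformlyDistributionLearnable (boundedGradientClass d ρ)
        (8 * 2 ^ (d + d) * Real.exp ((12 * d + 4) ^ 2 / 128)) (1 / 128) T S B ∧
      (∀ n : ℕ, T n ≤ (infer d).size) ∧
      (∀ n : ℕ, 2 ≤ n →
        S n ≤ 100000 * (√(2 * (d : ℝ)) * (ρ * √(n : ℝ)) ^ (2 * d) * Real.log n)) ∧
      (∀ n : ℕ, 2 ≤ n →
        B n ≤ 100000 * (√(2 * (d : ℝ)) * (ρ * √(n : ℝ)) ^ (2 * d) * Real.log n)) := by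
  obtain ⟨μ₀, hμ₀⟩ := hne
  have hρ := one_le_of_mem_boundedGradientClass hd hμ₀
  choose k hk hlow hhigh using fun n : ℕ => exists_gridSize (ρ ^ 2 * n)
  refine ⟨fun _ => (infer d).size,
    fun n => ((infer d).size + (Nat.size (k n) + 1) + k n ^ (d + d) * (Nat.size n + 1) : ℕ),
    fun n => (40 * (train d ρ).size * k n ^ (d + d) : ℕ), ⟨⟨train d ρ, infer d⟩, ?_⟩,
    fun _ => le_rfl, ?_⟩
  · intro n hn χ hχ
    refine ⟨table (k n), fun D q => hitCount {p | ∀ j, recordDigit (k n) j p ≤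
      queryDigit (k n) q j} D, fun D => ?_, fun D q hq => answers (hk n) D hq,
      fun D => Nat.cast_le.2 (space_le D), fun ε hε => ?_⟩
    · obtain ⟨s, hs, t, ht, he⟩ := runs_train D hd hn (hk n) (hlow n) (hhigh n)
      exact ⟨t, s, he, hs, by
        simpa only [Nat.cast_mul] using (Nat.cast_le (α := ℝ)).2 ht⟩
    · refine samplingLaw_gridError_le hχ hn (hk n) ?_ hε
      have h1 : (1 : ℝ) ≤ k n := by exact_mod_cast hk n
      have h2 := hhigh n
      push_cast at h2
      -- Since k ≥ 1, ρ²n < 2(k + 1)² ≤ 8k² ≤ 9k².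
      refine le_of_sq_le_sq ?_ (by positivity)
      rw [mul_pow, Real.sq_sqrt (Nat.cast_nonneg n)]
      nlinarith
  · have key : ∀ n : ℕ, 2 ≤ n → ∃ Q L : ℝ, (ρ * √(n : ℝ)) ^ (2 * d) = Q ∧ Real.log n = L ∧
        (2 : ℝ) ^ d * (k n : ℝ) ^ (d + d) ≤ Q ∧ 1 / 2 ≤ L ∧ (Nat.size n : ℝ) + 1 ≤ 6 * L ∧
        Q * L ≤ √(2 * (d : ℝ)) * Q * L := by
      intro n hn
      have hn' : (2 : ℝ) ≤ n := by exact_mod_cast hn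
      have hL : 1 / 2 ≤ Real.log n := by
        have := Real.log_le_log two_pos hn'
        linarith [Real.log_two_gt_d9]
      refine ⟨_, _, rfl, rfl, two_pow_mul_le hρ hn (hk n) (hlow n) d, hL,
        size_add_one_le_log hn, ?_⟩
      have h1 : 1 ≤ √(2 * (d : ℝ)) := by
        rw [Real.one_le_sqrt]
        have : (1 : ℝ) ≤ d := by exact_mod_cast hd
        linarith
      rw [mul_assoc]
      exact le_mul_of_one_le_left (by positivity) h1
    have hsq : ((d : ℝ) + 1) ^ 2 ≤ 4 * 2 ^ d := by exact_mod_cast succ_sq_le_two_pow d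
    constructor
    · intro n hn
      obtain ⟨Q, L, hQ, hL, hNQ, hL2, hsz, hQL⟩ := key n hn
      rw [hQ, hL]
      have hinf : ((infer d).size : ℝ) ≤ 200 * ((d : ℝ) + 1) ^ 2 := by
        exact_mod_cast size_infer_le d
      have hk1 : (1 : ℝ) ≤ k n := by exact_mod_cast hk n
      have hkN : (k n : ℝ) ≤ (k n : ℝ) ^ (d + d) := le_self_pow₀ hk1 (by omega)
      have hks : (Nat.size (k n) : ℝ) ≤ k n := by
        exact_mod_cast Nat.size_le.2 Nat.lt_two_pow_self
      have h2d : (1 : ℝ) ≤ 2 ^ d := one_le_pow₀ one_le_two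
      set N : ℝ := (k n : ℝ) ^ (d + d) with hN
      have hN1 : 1 ≤ N := hk1.trans hkN
      have hNQ' : N ≤ Q := le_trans (by nlinarith) hNQ
      have h2Q : (2 : ℝ) ^ d ≤ Q := le_trans (by nlinarith) hNQ
      push_cast
      have h1 : N * ((Nat.size n : ℝ) + 1) ≤ Q * (6 * L) := by gcongr; linarith
      have h2 : Q ≤ 2 * (Q * L) := by nlinarith
      have h3 : 0 ≤ Q * L := by nlinarith
      linarith
    · intro n hn
      obtain ⟨Q, L, hQ, hL, hNQ, hL2, hsz, hQL⟩ := key n hn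
      rw [hQ, hL]
      have htr : ((train d ρ).size : ℝ) ≤ 300 * ((d : ℝ) + 1) ^ 2 := by
        exact_mod_cast size_train_le d ρ
      set N : ℝ := (k n : ℝ) ^ (d + d) with hN
      have hN0 : 0 ≤ N := by positivity
      push_cast
      rw [← hN]
      -- The training cost is then at most 40 · 1200 · Q ≤ 96000 · Q · L, which is what fixes the
      -- constant 100000.
      have h1 : ((train d ρ).size : ℝ) * N ≤ 1200 * 2 ^ d * N := by gcongr; linarith
      have hQ0 : 0 ≤ Q := le_trans (by positivity) hNQ
      have h2 : Q ≤ 2 * (Q * L) := by nlinarith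
      nlinarith

end GridLearner

/-! ### Running one model inside another program -/

section Embed

/-- Renaming the arrays of an expression. -/
def RamExpr.rename (φ : ℕ → ℕ) : RamExpr → RamExpr
  | .const x => .const x
  | .read a e => .read (φ a) (e.rename φ)
  | .add e₁ e₂ => .add (e₁.rename φ) (e₂.rename φ)
  | .sub e₁ e₂ => .sub (e₁.rename φ) (e₂.rename φ)
  | .mul e₁ e₂ => .mul (e₁.rename φ) (e₂.rename φ)
  | .div e₁ e₂ => .div (e₁.rename φ) (e₂.rename φ)
  | .floor e => .floor (e.rename φ)

/-- Renaming the arrays of a program. -/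
def RamProg.rename (φ : ℕ → ℕ) : RamProg → RamProg
  | .skip => .skip
  | .write a i e => .write (φ a) (i.rename φ) (e.rename φ)
  | .emit e => .emit (e.rename φ)
  | .seq c₁ c₂ => .seq (c₁.rename φ) (c₂.rename φ)
  | .branch e₁ e₂ c₁ c₂ => .branch (e₁.rename φ) (e₂.rename φ) (c₁.rename φ) (c₂.rename φ)
  | .loop e₁ e₂ c => .loop (e₁.rename φ) (e₂.rename φ) (c.rename φ)

theorem RamExpr.size_rename (φ : ℕ → ℕ) (e : RamExpr) : (e.rename φ).size = e.size := by
  induction e <;> simp_all [RamExpr.rename, RamExpr.size]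

theorem RamExpr.eval_rename {φ : ℕ → ℕ} {s s' : RamState}
    (h : ∀ a m, s'.arr (φ a) m = s.arr a m) (e : RamExpr) :
    (e.rename φ).eval s' = e.eval s := by
  induction e <;> simp_all [RamExpr.rename, RamExpr.eval]

/-- Injectivity keeps distinct arrays distinct, so the run is simulated step by step with the same
count, and arrays outside the range of φ are untouched. -/
theorem RamExec.rename {φ : ℕ → ℕ} (hφ : φ.Injective) {c : RamProg} {s s₁ : RamState} {t : ℕ}
    (he : RamExec c s t s₁) : ∀ s' : RamState, (∀ a m, s'.arr (φ a) m = s.arr a m) →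
      ∃ s₁' : RamState, RamExec (c.rename φ) s' t s₁' ∧
        (∀ a m, s₁'.arr (φ a) m = s₁.arr a m) ∧ ∀ b ∉ Set.range φ, s₁'.arr b = s'.arr b := by
  induction he with
  | skip s => exact fun s' h => ⟨s', .skip s', h, fun _ _ => rfl⟩
  | write s a i e =>
    intro s' h
    have := RamExec.write s' (φ a) (i.rename φ) (e.rename φ)
    rw [RamExpr.size_rename, RamExpr.size_rename, RamExpr.eval_rename h,
      RamExpr.eval_rename h] at this
    refine ⟨_, this, fun a' m => ?_, fun b hb => ?_⟩
    · have hfun : s'.arr (φ a) = s.arr a := funext (h a)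
      by_cases ha : a' = a
      · subst ha; simp [hfun]
      · simp [Function.update_of_ne ha, Function.update_of_ne (hφ.ne ha), h]
    · have : b ≠ φ a := fun hba => hb ⟨a, hba.symm⟩
      simp [Function.update_of_ne this]
  | emit s e =>
    intro s' h
    have := RamExec.emit s' (e.rename φ)
    rw [RamExpr.size_rename] at this
    exact ⟨_, this, h, fun _ _ => rfl⟩
  | seq _ _ ih₁ ih₂ =>
    intro s' h
    obtain ⟨s₁', he₁, h₁, hb₁⟩ := ih₁ s' h
    obtain ⟨s₂', he₂, h₂, hb₂⟩ := ih₂ s₁' h₁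
    exact ⟨s₂', .seq he₁ he₂, h₂, fun b hb => (hb₂ b hb).trans (hb₁ b hb)⟩
  | @branch_true _ _ _ e₁ e₂ _ _ hc _ ih =>
    intro s' h
    obtain ⟨s₁', he₁, h₁, hb₁⟩ := ih s' h
    refine ⟨s₁', ?_, h₁, hb₁⟩
    rw [← e₁.size_rename φ, ← e₂.size_rename φ]
    exact .branch_true (by rwa [RamExpr.eval_rename h, RamExpr.eval_rename h]) he₁
  | @branch_false _ _ _ e₁ e₂ _ _ hc _ ih =>
    intro s' h
    obtain ⟨s₁', he₁, h₁, hb₁⟩ := ih s' h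
    refine ⟨s₁', ?_, h₁, hb₁⟩
    rw [← e₁.size_rename φ, ← e₂.size_rename φ]
    exact .branch_false (by rwa [RamExpr.eval_rename h, RamExpr.eval_rename h]) he₁
  | @loop_step _ _ _ _ _ e₁ e₂ _ hc _ _ ih₁ ih₂ =>
    intro s' h
    obtain ⟨s₁', he₁, h₁, hb₁⟩ := ih₁ s' h
    obtain ⟨s₂', he₂, h₂, hb₂⟩ := ih₂ s₁' h₁
    refine ⟨s₂', ?_, h₂, fun b hb => (hb₂ b hb).trans (hb₁ b hb)⟩
    rw [← e₁.size_rename φ, ← e₂.size_rename φ]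
    exact .loop_step (by rwa [RamExpr.eval_rename h, RamExpr.eval_rename h]) he₁ he₂
  | _ =>
    rename_i s e₁ e₂ c hc
    intro s' h
    refine ⟨s', ?_, h, fun _ _ => rfl⟩
    rw [← e₁.size_rename φ, ← e₂.size_rename φ]
    exact .loop_exit (by rwa [RamExpr.eval_rename h, RamExpr.eval_rename h])

/-- Fill the array `b` with the values of the first `m` of the expressions `f`. -/
noncomputable def RamProg.fill (b : ℕ) (f : ℕ → RamExpr) : ℕ → RamProg
  | 0 => .skip
  | m + 1 => .seq (fill b f m) (.write b (.const m) (f m))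

/-- The hypothesis, with x arbitrary, says that the values do not depend on the array being filled.
-/
theorem RamProg.runs_fill {b : ℕ} {f : ℕ → RamExpr} {s : RamState} {v : ℕ → ℝ} (m : ℕ)
    (hf : ∀ j x, (f j).eval ⟨Function.update s.arr b x, s.out⟩ = v j) :
    (RamProg.fill b f m).Runs s (RamProg.fill b f m).size
      ⟨Function.update s.arr b fun j => if j < m then v j else s.arr b j, s.out⟩ := by
  induction m with
  | zero =>
    refine ⟨1, le_rfl, ?_⟩
    have := RamExec.skip s
    simpa [Function.update_eq_self, RamProg.fill] using this
  | succ m ih =>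
    have hw := RamExec.write
      ⟨Function.update s.arr b fun j => if j < m then v j else s.arr b j, s.out⟩
      b (.const m) (f m)
    have h := ih.seq ⟨_, le_rfl, hw⟩
    rw [hf] at h
    have heq : Function.update (fun j => if j < m then v j else s.arr b j) m (v m) =
        fun j => if j < m + 1 then v j else s.arr b j := by
      funext j
      rcases lt_trichotomy j m with hj | hj | hj
      · simp [hj.ne, hj, Nat.lt_succ_of_lt hj]
      · subst hj; simp
      · simp [hj.ne', not_lt.2 hj.le, show ¬ j < m + 1 by omega]
    simp only [RamExpr.eval, Nat.floor_natCast, Function.update_self, Function.update_idem,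
      heq] at h
    refine h.mono ?_
    simp only [RamProg.fill, RamProg.size, RamExpr.size]
    omega

/-- Run the model `m` on the query of the surrounding program, in the arrays given by `φ`. -/
noncomputable def QueryModel.embed (m : QueryModel) (d : ℕ) (φ : ℕ → ℕ) : RamProg :=
  .seq (.fill (φ 0) (fun j => .read 0 (.const j)) (d + d))
    (.seq (.fill (φ 1) (fun j => .const (m.table.getD j 0 : ℕ)) m.table.length)
      (m.code.rename φ))

/-- Copying the query and the table into fresh zero arrays recreates, under φ, the state from which
the model expects to start. -/
theorem QueryModel.runs_embed {d : ℕ} {m : QueryModel} {φ : ℕ → ℕ} (hφ : φ.Injective)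
    (hφ0 : 0 ∉ Set.range φ) {q : RangeQuery d} {v T : ℝ} (hm : m.Answers q v T) {s : RamState}
    (hs0 : s.arr 0 = (evalStart [] q).arr 0) (hs : ∀ a j, s.arr (φ a) j = 0) :
    ∃ s' : RamState, (m.embed d φ).Runs s ((m.embed d φ).size + ⌊T⌋₊) s' ∧
      s'.arr (φ 2) 0 = v ∧ ∀ b ∉ Set.range φ, s'.arr b = s.arr b := by
  obtain ⟨t, s₃, he, hv, ht⟩ := hm
  have h00 : φ 0 ≠ 0 := fun h => hφ0 ⟨0, h⟩
  have h01 : φ 1 ≠ φ 0 := hφ.ne one_ne_zero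
  have h1 := RamProg.runs_fill (b := φ 0) (f := fun j => .read 0 (.const j)) (s := s)
    (v := fun j => s.arr 0 j) (d + d) fun j x => by
      simp [RamExpr.eval, Function.update_of_ne h00.symm]
  set s₁ : RamState := ⟨Function.update s.arr (φ 0) fun j => if j < d + d then s.arr 0 j
    else s.arr (φ 0) j, s.out⟩ with hs₁
  have h2 := RamProg.runs_fill (b := φ 1) (f := fun j => .const (m.table.getD j 0 : ℕ)) (s := s₁)
    (v := fun j => (m.table.getD j 0 : ℕ)) m.table.length fun j x => by simp [RamExpr.eval]
  set s₂ : RamState := ⟨Function.update s₁.arr (φ 1) fun j => if j < m.table.length then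
    ((m.table.getD j 0 : ℕ) : ℝ) else s₁.arr (φ 1) j, s₁.out⟩ with hs₂
  have hrel : ∀ a j, s₂.arr (φ a) j = (evalStart m.table q).arr a j := by
    intro a j
    by_cases ha1 : a = 1
    · subst ha1
      by_cases hj : j < m.table.length
      · simp [hs₂, evalStart, hj]
      · simp [hs₂, hs₁, evalStart, hj, Function.update_of_ne h01, hs]
    · rw [hs₂]
      simp only [Function.update_of_ne (hφ.ne ha1)]
      by_cases ha0 : a = 0
      · subst ha0
        by_cases hj : j < d + d
        · simp [hs₁, hs0, evalStart, hj]
        · simp [hs₁, evalStart, hj, hs]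
      · simp [hs₁, Function.update_of_ne (hφ.ne ha0), hs, evalStart, ha0, ha1]
  obtain ⟨s₃', he', hr', hb'⟩ := he.rename hφ s₂ hrel
  refine ⟨s₃', (h1.seq (h2.seq ⟨t, Nat.le_floor ht, he'⟩)).mono ?_, (hr' 2 0).trans hv,
    fun b hb => ?_⟩
  · simp only [QueryModel.embed, RamProg.size]
    omega
  · have hb0 : b ≠ φ 0 := fun h => hb ⟨0, h.symm⟩
    have hb1 : b ≠ φ 1 := fun h => hb ⟨1, h.symm⟩
    rw [hb' b hb, hs₂]
    simp [Function.update_of_ne hb1, hs₁, Function.update_of_ne hb0]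

/-- A program that computes `w` times the answer of `m₁` plus the answer of `m₂`. -/
noncomputable def QueryModel.linComb (m₁ m₂ : QueryModel) (d : ℕ) (w : ℝ) : QueryModel :=
  ⟨.seq (m₁.embed d fun a => 2 * a + 3) (.seq (m₂.embed d fun a => 2 * a + 4)
    (.write 2 (.const 0) (.add (.mul (.const w) (.read 7 (.const 0))) (.read 8 (.const 0))))), []⟩

theorem QueryModel.answers_linComb {d : ℕ} {m₁ m₂ : QueryModel} {q : RangeQuery d}
    {v₁ v₂ T₁ T₂ : ℝ} (h₁ : m₁.Answers q v₁ T₁) (h₂ : m₂.Answers q v₂ T₂) (w : ℝ) :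
    (m₁.linComb m₂ d w).Answers q (w * v₁ + v₂)
      ((m₁.linComb m₂ d w).code.size + ⌊T₁⌋₊ + ⌊T₂⌋₊ : ℕ) := by
  -- Odd and even array names keep the two runs apart and away from the query in array 0. The
  -- answers, in array 2 of each model, land in arrays 7 and 8.
  have hi₁ : Function.Injective fun a : ℕ => 2 * a + 3 := fun a b h => by simpa using h
  have hi₂ : Function.Injective fun a : ℕ => 2 * a + 4 := fun a b h => by simpa using h
  obtain ⟨s₁, hr₁, hv₁, hb₁⟩ := QueryModel.runs_embed hi₁ (by simp) h₁
    (s := evalStart [] q) rfl fun a j => by simp [evalStart]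
  obtain ⟨s₂, hr₂, hv₂, hb₂⟩ := QueryModel.runs_embed hi₂ (by simp) h₂
    (s := s₁) (hb₁ 0 (by simp)) fun a j => by
      rw [hb₁ _ (by rintro ⟨b, hb⟩; simp only at hb; omega)]
      simp [evalStart]
  have hv₁' : s₂.arr 7 0 = v₁ := by
    rw [hb₂ _ (by rintro ⟨b, hb⟩; simp only at hb; omega)]
    exact hv₁
  have hw := RamExec.write s₂ 2 (.const 0)
    (.add (.mul (.const w) (.read 7 (.const 0))) (.read 8 (.const 0)))
  obtain ⟨t, ht, he⟩ := hr₁.seq (hr₂.seq ⟨_, le_rfl, hw⟩)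
  refine ⟨t, _, he, ?_, Nat.cast_le.2 (ht.trans ?_)⟩
  · simp only [RamExpr.eval, Nat.floor_zero, Function.update_self, hv₁']
    rw [show s₂.arr 8 0 = v₂ from hv₂]
  · simp only [QueryModel.linComb, RamProg.size]
    omega

/-- Linear combinations of functions with constant-time models have constant-time models, with
bounds that do not depend on the coefficients. -/
theorem exists_model_linearCombination {d : ℕ}
    (X : Finset (ProbabilityMeasure (DataPoint d)))
    (hX : ∀ μ ∈ X, ConstantTimeCardinality μ) :
    ∃ K : ℕ, ∀ w : ProbabilityMeasure (DataPoint d) → ℝ, ∃ c : RamProg, c.size ≤ K ∧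
      ∀ q ∈ queryDomain d,
        QueryModel.Answers ⟨c, []⟩ q (∑ μ ∈ X, w μ * matchProb μ q) K := by
  classical
  induction X using Finset.induction_on with
  | empty =>
    refine ⟨1, fun w => ⟨.skip, le_rfl, fun q _ => ⟨1, _, .skip _, ?_, by simp⟩⟩⟩
    simp [evalStart]
  | insert μ X hμ ih =>
    obtain ⟨K, hK⟩ := ih fun ν hν => hX ν (Finset.mem_insert_of_mem hν)
    obtain ⟨m, T, hm⟩ := hX μ (Finset.mem_insert_self μ X)
    -- The overhead of embedding does not depend on c, so K can be fixed before the weights are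
    -- chosen.
    have hsize : ∀ (c : RamProg) (φ : ℕ → ℕ), (QueryModel.embed ⟨c, []⟩ d φ).size =
        (QueryModel.embed ⟨.skip, []⟩ d φ).size - 1 + c.size := by
      have hren : ∀ (φ : ℕ → ℕ) (c : RamProg), (c.rename φ).size = c.size := by
        intro φ c
        induction c <;> simp_all [RamProg.rename, RamProg.size, RamExpr.size_rename]
      intro c φ
      simp only [QueryModel.embed, RamProg.size, hren]
      omega
    refine ⟨(m.embed d fun a => 2 * a + 3).size +
      ((QueryModel.embed ⟨.skip, []⟩ d fun a => 2 * a + 4).size - 1 + K) + 11 + ⌊T⌋₊ + K,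
      fun w => ?_⟩
    obtain ⟨c, hc, hq⟩ := hK w
    have hle : (m.linComb ⟨c, []⟩ d (w μ)).code.size ≤ (m.embed d fun a => 2 * a + 3).size +
        ((QueryModel.embed ⟨.skip, []⟩ d fun a => 2 * a + 4).size - 1 + K) + 11 := by
      simp only [QueryModel.linComb, RamProg.size, RamExpr.size, hsize c]
      omega
    refine ⟨(m.linComb ⟨c, []⟩ d (w μ)).code, by omega, fun q hqd => ?_⟩
    rw [Finset.sum_insert hμ]
    obtain ⟨t, s, he, hv, ht⟩ := QueryModel.answers_linComb (hm q hqd) (hq q hqd) (w μ)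
    refine ⟨t, s, he, hv, ht.trans (Nat.cast_le.2 ?_)⟩
    rw [Nat.floor_natCast]
    omega

/-- Finitely many distributions with constant-time cardinality functions are learned with constant
cost: the mixture can be written into the inference program. -/
theorem distributionLearnable_of_constantTime {d : ℕ} {κ₁ κ₂ : ℝ}
    {X : Set (ProbabilityMeasure (DataPoint d))} (hfin : X.Finite)
    (hX : ∀ μ ∈ X, ConstantTimeCardinality μ) :
    ∃ (K : ℝ) (T S B : ℕ → ℝ), DistributionLearnable X κ₁ κ₂ T S B ∧
      ∀ n : ℕ, T n ≤ K ∧ S n ≤ K ∧ n * B n ≤ K := by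
  classical
  obtain ⟨K, hK⟩ := exists_model_linearCombination hfin.toFinset
    fun μ hμ => hX μ (hfin.mem_toFinset.1 hμ)
  -- Training is a single `skip`, one operation in all, hence B_n = 1/n.
  refine ⟨K + 1, fun _ => K, fun _ => K, fun n => 1 / n, ?_, fun n => ⟨by linarith, by linarith, ?_⟩⟩
  · intro n hn χ hχ
    have hn' : (0 : ℝ) < n := Nat.cast_pos.2 hn
    obtain ⟨c, hc, hq⟩ := hK fun μ => (Finset.univ.filter fun i => χ i = μ).card
    have hsum : ∀ q, distCardinalityFn χ q = ∑ μ ∈ hfin.toFinset,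
        ((Finset.univ.filter fun i => χ i = μ).card : ℝ) * matchProb μ q := by
      intro q
      rw [distCardinalityFn_eq_sum, ← Finset.sum_fiberwise_of_maps_to (t := hfin.toFinset)
        (g := χ) fun i _ => hfin.mem_toFinset.2 (hχ i)]
      refine Finset.sum_congr rfl fun μ _ => ?_
      rw [Finset.sum_congr rfl (g := fun _ => matchProb μ q) fun i hi => by
        rw [(Finset.mem_filter.1 hi).2]]
      simp
    refine ⟨⟨.skip, c⟩, fun _ => [], fun _ => distCardinalityFn χ, fun D => ?_, fun D q hqd => ?_,
      fun D => ?_, fun ε hε => ?_⟩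
    · refine ⟨1, _, .skip _, rfl, ?_⟩
      rw [mul_one_div_cancel hn'.ne']
      simp
    · have h := hq q hqd
      rwa [← hsum] at h
    · simpa [QueryModel.space] using hc
    · have hε0 : 0 < ε := (Real.sqrt_pos.2 hn').trans_le hε
      have hempty : {D : Dataset d n | ENNReal.ofReal ε ≤ querySupNorm fun q =>
          distCardinalityFn χ q - distCardinalityFn χ q} = ∅ := by
        ext D
        simp [querySupNorm, hε0]
      rw [hempty]
      simp
  · have hK0 : (0 : ℝ) ≤ K := Nat.cast_nonneg K
    rcases Nat.eq_zero_or_pos n with h | h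
    · subst h; simp; linarith
    · rw [mul_one_div_cancel (Nat.cast_pos.2 h).ne']
      linarith

end Embed

/-! ### Assembly of the constants: κ₁ and κ₂ come from the grid learner, and the second class allows
any values. -/

theorem mainTheorem9 :
    ∃ C : ℝ, 0 < C ∧ ∀ d : ℕ, 0 < d →
      ∃ κ₁ κ₂ C' : ℝ, 0 < κ₁ ∧ 0 < κ₂ ∧ 0 < C' ∧
        (∀ ρ : ℝ, (boundedGradientClass d ρ).Nonempty →
          ∃ T S B : ℕ → ℝ,
            UniformlyDistributionLearnable (boundedGradientClass d ρ) κ₁ κ₂ T S B ∧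
            (∀ n : ℕ, T n ≤ C') ∧
            (∀ n : ℕ, 2 ≤ n →
              S n ≤ C * (√(2 * (d : ℝ)) * (ρ * √(n : ℝ)) ^ (2 * d) * Real.log n)) ∧
            (∀ n : ℕ, 2 ≤ n →
              B n ≤ C * (√(2 * (d : ℝ)) * (ρ * √(n : ℝ)) ^ (2 * d) * Real.log n))) ∧
        (∀ X : Set (ProbabilityMeasure (DataPoint d)), X.Finite →
          (∀ μ ∈ X, ConstantTimeCardinality μ) →
          ∃ (K : ℝ) (T S B : ℕ → ℝ),
            DistributionLearnable X κ₁ κ₂ T S B ∧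
            ∀ n : ℕ, T n ≤ K ∧ S n ≤ K ∧ n * B n ≤ K) := by
  refine ⟨100000, by norm_num, fun d hd =>
    ⟨8 * 2 ^ (d + d) * Real.exp ((12 * d + 4) ^ 2 / 128), 1 / 128, (GridLearner.infer d).size,
      by positivity, by norm_num, ?_,
      fun ρ hne => boundedGradientClass_uniformlyDistributionLearnable hd hne,
      fun X hfin hX => distributionLearnable_of_constantTime hfin hX⟩⟩
  exact_mod_cast (by simp only [GridLearner.infer, RamProg.size]; omega :
    0 < (GridLearner.infer d).size)
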